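/- A monoidal signature $\Sigma$ is a family of sets $\Sigma_{k,l}$ ($k,l\in\mathbb N$) of operations of arity $k$ and coarity $l$. A PROP is a symmetric strict monoidal category whose objects are the natural numbers, with $\oplus$ on objects given by addition; PROP morphisms are identity-on-objects symmetric strict monoidal functors. Let $\mathbf{Syn}(\Sigma)$ be the PROP freely generated by $\Sigma$: its arrows $n\to m$ are the $\Sigma$-terms $n\to m$, built from the operations, the identities $\mathrm{id}_n$ and the symmetries $\sigma_{m,n}$ by sequential and parallel composition, modulo the laws of symmetric strict monoidal categories. A $\Sigma$-hypergraph $G$ consists of a finite set of nodes and, for all $k,l$, a finite set of hyperedges $h$ with ordered sources $s_1(h),\dots,s_k(h)$ and ordered targets $t_1(h),\dots,t_l(h)$ among the nodes and a label in $\Sigma_{k,l}$; homomorphisms preserve sources, targets and labels. Let $\mathbf{Csp}_D(\mathbf{Hyp}_\Sigma)$ be the PROP whose arrows $n\to m$ are the cospans $n\to G\leftarrow m$ of $\Sigma$-hypergraphs, up to isomorphism of cospans, where $n$ and $m$ stand for the discrete hypergraphs (no hyperedges) with $n$ and $m$ nodes; composition is by pushout and $\oplus$ is by coproduct. Let $[\![\cdot]\!]:\mathbf{Syn}(\Sigma)\to\mathbf{Csp}_D(\mathbf{Hyp}_\Sigma)$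 be the PROP morphism that sends an operation $o\in\Sigma_{k,l}$ to the cospan $k\to G_o\leftarrow l$, where $G_o$ has $k+l$ distinct nodes and a single hyperedge, labelled $o$, whose list of sources is the image of the left leg and whose list of targets is the image of the right leg, in order. The in-degree (out-degree) of a node $v$ is the number of pairs $(h,i)$ such that $v$ is the $i$-th target (source) of the hyperedge $h$. A cospan $n\xrightarrow{f}G\xleftarrow{g}m$ is monogamous if $f$ and $g$ are monomorphisms and, for every node $v$ of $G$, the in-degree of $v$ is $0$ if $v$ is in the image of $f$ and $1$ otherwise, and the out-degree of $v$ is $0$ if $v$ is in the image of $g$ and $1$ otherwise. A path from a node $v$ to a node $w$ is a non-empty sequence of hyperedges $h_1,\dots,h_r$ such that $v$ is a source of $h_1$, $w$ is a target of $h_r$, and for each $i<r$ some target of $h_i$ is a source of $h_{i+1}$. The cospan is acyclic if there is no path in $G$ from a node to itself. Theorem. Let $\Sigma$ be a monoidal signature and let $n\to G\leftarrow m$ be a cospan of $\Sigma$-hypergraphs, with $n,m\in\mathbb N$ regarded as discrete hypergraphs. Then $n\to G\leftarrow m$ is in the image of $[\![\cdot]\!]:\mathbf{Syn}(\Sigma)\to\mathbf{Csp}_D(\mathbf{Hyp}_\Sigma)$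 if and only if it is monogamous and acyclic. -/

import Mathlib

open CategoryTheory CategoryTheory.Limits

universe u w w'

namespace StringDiagram

/-! ### Monoidal signatures and PROPs -/

/-- A monoidal signature: for all `k l : ℕ`, a set of operations of arity `k` and coarity `l`. -/
structure Signature where
  Op : ℕ → ℕ → Type u

/-- Transport along equalities of arity and coarity.  In a PROP the objects `(m + n) + o` and
`m + (n + o)`, or `0 + n` and `n`, are equal; this is used to state laws between them. -/
def castHom {H : ℕ → ℕ → Type w} {n m n' m' : ℕ} (hn : n = n') (hm : m = m') (x : H n m) :
    H n' m' :=
  hm ▸ hn ▸ x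

/-- A PROP: a symmetric strict monoidal category whose objects are the natural numbers, with
`⊕` on objects being addition. Composition is written in diagrammatic order. -/
structure PROP where
  Hom : ℕ → ℕ → Type w
  id (n : ℕ) : Hom n n
  comp {n m k : ℕ} : Hom n m → Hom m k → Hom n k
  tensor {n m n' m' : ℕ} : Hom n m → Hom n' m' → Hom (n + n') (m + m')
  symm (m n : ℕ) : Hom (m + n) (n + m)
  comp_assoc {a b c d : ℕ} (s : Hom a b) (t : Hom b c) (u : Hom c d) :
    comp (comp s t) u = comp s (comp t u)
  id_comp {a b : ℕ} (s : Hom a b) : comp (id a) s = s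
  comp_id {a b : ℕ} (s : Hom a b) : comp s (id b) = s
  tensor_assoc {a b a' b' a'' b'' : ℕ} (s : Hom a b) (t : Hom a' b') (u : Hom a'' b'') :
    castHom (Nat.add_assoc a a' a'') (Nat.add_assoc b b' b'') (tensor (tensor s t) u) =
      tensor s (tensor t u)
  id_tensor {a b : ℕ} (s : Hom a b) :
    castHom (Nat.zero_add a) (Nat.zero_add b) (tensor (id 0) s) = s
  tensor_id {a b : ℕ} (s : Hom a b) : tensor s (id 0) = s
  interchange {a b c a' b' c' : ℕ} (s : Hom a b) (u : Hom b c) (t : Hom a' b') (v : Hom b' c') :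
    tensor (comp s u) (comp t v) = comp (tensor s t) (tensor u v)
  id_tensor_id (m n : ℕ) : tensor (id m) (id n) = id (m + n)
  symm_hexagon (m n o : ℕ) :
    castHom (Nat.add_assoc m n o) (Nat.add_assoc n o m).symm
      (comp (tensor (symm m n) (id o))
        (castHom (Nat.add_assoc n m o).symm rfl (tensor (id n) (symm m o)))) = symm m (n + o)
  symm_symm (m n : ℕ) : comp (symm m n) (symm n m) = id (m + n)
  symm_natural {a b : ℕ} (s : Hom a b) (m : ℕ) :
    comp (tensor s (id m)) (symm b m) = comp (symm a m) (tensor (id m) s)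

/-- A morphism of PROPs: an identity-on-objects symmetric strict monoidal functor. -/
structure PROP.Morphism (P : PROP.{w}) (Q : PROP.{w'}) where
  map {n m : ℕ} : P.Hom n m → Q.Hom n m
  map_id (n : ℕ) : map (P.id n) = Q.id n
  map_comp {n m k : ℕ} (s : P.Hom n m) (t : P.Hom m k) :
    map (P.comp s t) = Q.comp (map s) (map t)
  map_tensor {n m n' m' : ℕ} (s : P.Hom n m) (t : P.Hom n' m') :
    map (P.tensor s t) = Q.tensor (map s) (map t)
  map_symm (m n : ℕ) : map (P.symm m n) = Q.symm m n

/-! ### The PROP freely generated by a signature -/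

/-- `S`-terms. -/
inductive Term (S : Signature.{u}) : ℕ → ℕ → Type u
  | op {k l : ℕ} (o : S.Op k l) : Term S k l
  | id (n : ℕ) : Term S n n
  | symm (m n : ℕ) : Term S (m + n) (n + m)
  | comp {n m k : ℕ} (s : Term S n m) (t : Term S m k) : Term S n k
  | tensor {n m n' m' : ℕ} (s : Term S n m) (t : Term S n' m') : Term S (n + n') (m + m')

/-- Equality of `S`-terms modulo the laws of symmetric strict monoidal categories: the smallest
congruence that contains them. -/
inductive Term.Equiv (S : Signature.{u}) : {n m : ℕ} → Term S n m → Term S n m → Prop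
  | refl {n m : ℕ} (s : Term S n m) : Term.Equiv S s s
  | symm {n m : ℕ} {s t : Term S n m} : Term.Equiv S s t → Term.Equiv S t s
  | trans {n m : ℕ} {s t r : Term S n m} :
      Term.Equiv S s t → Term.Equiv S t r → Term.Equiv S s r
  | comp_congr {n m k : ℕ} {s s' : Term S n m} {t t' : Term S m k} :
      Term.Equiv S s s' → Term.Equiv S t t' → Term.Equiv S (s.comp t) (s'.comp t')
  | tensor_congr {n m n' m' : ℕ} {s s' : Term S n m} {t t' : Term S n' m'} :
      Term.Equiv S s s' → Term.Equiv S t t' → Term.Equiv S (s.tensor t) (s'.tensor t')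
  | comp_assoc {a b c d : ℕ} (s : Term S a b) (t : Term S b c) (r : Term S c d) :
      Term.Equiv S ((s.comp t).comp r) (s.comp (t.comp r))
  | id_comp {a b : ℕ} (s : Term S a b) : Term.Equiv S ((Term.id a).comp s) s
  | comp_id {a b : ℕ} (s : Term S a b) : Term.Equiv S (s.comp (Term.id b)) s
  | tensor_assoc {a b a' b' a'' b'' : ℕ}
      (s : Term S a b) (t : Term S a' b') (r : Term S a'' b'') :
      Term.Equiv S
        (castHom (Nat.add_assoc a a' a'') (Nat.add_assoc b b' b'') ((s.tensor t).tensor r))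
        (s.tensor (t.tensor r))
  | id_tensor {a b : ℕ} (s : Term S a b) :
      Term.Equiv S (castHom (Nat.zero_add a) (Nat.zero_add b) ((Term.id 0).tensor s)) s
  | tensor_id {a b : ℕ} (s : Term S a b) : Term.Equiv S (s.tensor (Term.id 0)) s
  | interchange {a b c a' b' c' : ℕ}
      (s : Term S a b) (r : Term S b c) (t : Term S a' b') (v : Term S b' c') :
      Term.Equiv S ((s.comp r).tensor (t.comp v)) ((s.tensor t).comp (r.tensor v))
  | id_tensor_id (m n : ℕ) : Term.Equiv S ((Term.id m).tensor (Term.id n)) (Term.id (m + n))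
  | symm_hexagon (m n o : ℕ) :
      Term.Equiv S
        (castHom (Nat.add_assoc m n o) (Nat.add_assoc n o m).symm
          (((Term.symm m n).tensor (Term.id o)).comp
            (castHom (Nat.add_assoc n m o).symm rfl ((Term.id n).tensor (Term.symm m o)))))
        (Term.symm m (n + o))
  | symm_symm (m n : ℕ) :
      Term.Equiv S ((Term.symm m n).comp (Term.symm n m)) (Term.id (m + n))
  | symm_natural {a b : ℕ} (s : Term S a b) (m : ℕ) :
      Term.Equiv S ((s.tensor (Term.id m)).comp (Term.symm b m))
        ((Term.symm a m).comp ((Term.id m).tensor s))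

instance Term.setoid (S : Signature.{u}) (n m : ℕ) : Setoid (Term S n m) where
  r := Term.Equiv S
  iseqv := ⟨Term.Equiv.refl, Term.Equiv.symm, Term.Equiv.trans⟩

theorem mk_castHom (S : Signature.{u}) {n m n' m' : ℕ} (hn : n = n') (hm : m = m')
    (s : Term S n m) :
    castHom (H := fun a b => Quotient (Term.setoid S a b)) hn hm (Quotient.mk _ s) =
      Quotient.mk _ (castHom hn hm s) := by
  subst hn hm; rfl

/-- The PROP `Syn(S)`, whose arrows are `S`-terms modulo the laws of symmetric strict monoidal
categories. -/
def Syn (S : Signature.{u}) : PROP.{u} where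
  Hom n m := Quotient (Term.setoid S n m)
  id n := Quotient.mk _ (Term.id n)
  comp := Quotient.map₂ Term.comp fun _ _ h _ _ h' => Term.Equiv.comp_congr h h'
  tensor := Quotient.map₂ Term.tensor fun _ _ h _ _ h' => Term.Equiv.tensor_congr h h'
  symm m n := Quotient.mk _ (Term.symm m n)
  comp_assoc s t r := by
    induction s using Quotient.inductionOn
    induction t using Quotient.inductionOn
    induction r using Quotient.inductionOn
    exact Quotient.sound (Term.Equiv.comp_assoc _ _ _)
  id_comp s := by
    induction s using Quotient.inductionOn
    exact Quotient.sound (Term.Equiv.id_comp _)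
  comp_id s := by
    induction s using Quotient.inductionOn
    exact Quotient.sound (Term.Equiv.comp_id _)
  tensor_assoc s t r := by
    induction s using Quotient.inductionOn
    induction t using Quotient.inductionOn
    induction r using Quotient.inductionOn
    exact (mk_castHom S _ _ _).trans (Quotient.sound (Term.Equiv.tensor_assoc _ _ _))
  id_tensor s := by
    induction s using Quotient.inductionOn
    exact (mk_castHom S _ _ _).trans (Quotient.sound (Term.Equiv.id_tensor _))
  tensor_id s := by
    induction s using Quotient.inductionOn
    exact Quotient.sound (Term.Equiv.tensor_id _)
  interchange s r t v := by
    induction s using Quotient.inductionOn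
    induction r using Quotient.inductionOn
    induction t using Quotient.inductionOn
    induction v using Quotient.inductionOn
    exact Quotient.sound (Term.Equiv.interchange _ _ _ _)
  id_tensor_id m n := Quotient.sound (Term.Equiv.id_tensor_id m n)
  symm_hexagon m n o := by
    simp only [Quotient.map₂_mk]
    rw [mk_castHom]
    exact (mk_castHom S _ _ _).trans (Quotient.sound (Term.Equiv.symm_hexagon m n o))
  symm_symm m n := Quotient.sound (Term.Equiv.symm_symm m n)
  symm_natural s m := by
    induction s using Quotient.inductionOn
    exact Quotient.sound (Term.Equiv.symm_natural _ m)

/-- Interpretation of terms in a PROP, given the interpretation of the operations. -/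
def Term.eval {S : Signature.{u}} (P : PROP.{w}) (φ : ∀ {k l : ℕ}, S.Op k l → P.Hom k l) :
    {n m : ℕ} → Term S n m → P.Hom n m
  | _, _, .op o => φ o
  | _, _, .id n => P.id n
  | _, _, .symm m n => P.symm m n
  | _, _, .comp s t => P.comp (s.eval P φ) (t.eval P φ)
  | _, _, .tensor s t => P.tensor (s.eval P φ) (t.eval P φ)

theorem Term.eval_castHom {S : Signature.{u}} (P : PROP.{w})
    (φ : ∀ {k l : ℕ}, S.Op k l → P.Hom k l) {n m n' m' : ℕ} (hn : n = n') (hm : m = m')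
    (s : Term S n m) : (castHom hn hm s).eval P φ = castHom hn hm (s.eval P φ) := by
  subst hn hm; rfl

theorem Term.eval_sound {S : Signature.{u}} (P : PROP.{w})
    (φ : ∀ {k l : ℕ}, S.Op k l → P.Hom k l) {n m : ℕ} {s t : Term S n m}
    (h : Term.Equiv S s t) : s.eval P φ = t.eval P φ := by
  induction h with
  | refl => rfl
  | symm _ ih => exact ih.symm
  | trans _ _ ih ih' => exact ih.trans ih'
  | comp_congr _ _ ih ih' => simp only [Term.eval, ih, ih']
  | tensor_congr _ _ ih ih' => simp only [Term.eval, ih, ih']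
  | comp_assoc => exact P.comp_assoc _ _ _
  | id_comp => exact P.id_comp _
  | comp_id => exact P.comp_id _
  | tensor_assoc => rw [Term.eval_castHom]; exact P.tensor_assoc _ _ _
  | id_tensor => rw [Term.eval_castHom]; exact P.id_tensor _
  | tensor_id => exact P.tensor_id _
  | interchange => exact P.interchange _ _ _ _
  | id_tensor_id => exact P.id_tensor_id _ _
  | symm_hexagon =>
    rw [Term.eval_castHom]; simp only [Term.eval, Term.eval_castHom]
    exact P.symm_hexagon _ _ _
  | symm_symm => exact P.symm_symm _ _
  | symm_natural => exact P.symm_natural _ _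

/-- The PROP morphism `Syn(S) → P` determined by its action `φ` on the generators. -/
def Syn.lift {S : Signature.{u}} (P : PROP.{w}) (φ : ∀ {k l : ℕ}, S.Op k l → P.Hom k l) :
    (Syn S).Morphism P where
  map := Quotient.lift (Term.eval P φ) fun _ _ h => Term.eval_sound P φ h
  map_id _ := rfl
  map_comp s t := by
    induction s using Quotient.inductionOn
    induction t using Quotient.inductionOn
    rfl
  map_tensor s t := by
    induction s using Quotient.inductionOn
    induction t using Quotient.inductionOn
    rfl
  map_symm _ _ := rfl

/-! ### Labelled hypergraphs -/

/-- An `S`-labelled hypergraph: a finite set of nodes and, for all `k l : ℕ`, a finite set of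
hyperedges with `k` ordered sources and `l` ordered targets, each labelled by an operation of
arity `k` and coarity `l`. -/
structure Hyp (S : Signature.{u}) where
  Node : Type
  Edge : ℕ → ℕ → Type
  finite_node : Finite Node
  finite_edge : ∀ k l, Finite (Edge k l)
  src : ∀ {k l : ℕ}, Edge k l → Fin k → Node
  tgt : ∀ {k l : ℕ}, Edge k l → Fin l → Node
  label : ∀ {k l : ℕ}, Edge k l → S.Op k l

namespace Hyp

variable {S : Signature.{u}}

/-- Homomorphisms of `S`-labelled hypergraphs. -/
@[ext]
structure Hom (G H : Hyp S) where
  node : G.Node → H.Node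
  edge : ∀ {k l : ℕ}, G.Edge k l → H.Edge k l
  src_edge : ∀ {k l : ℕ} (e : G.Edge k l) (i : Fin k), H.src (edge e) i = node (G.src e i)
  tgt_edge : ∀ {k l : ℕ} (e : G.Edge k l) (i : Fin l), H.tgt (edge e) i = node (G.tgt e i)
  label_edge : ∀ {k l : ℕ} (e : G.Edge k l), H.label (edge e) = G.label e

instance : Category (Hyp S) where
  Hom := Hom
  id G := ⟨fun v => v, fun e => e, fun _ _ => rfl, fun _ _ => rfl, fun _ => rfl⟩
  comp f g :=
    { node := fun v => g.node (f.node v)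
      edge := fun e => g.edge (f.edge e)
      src_edge := fun e i => by rw [g.src_edge, f.src_edge]
      tgt_edge := fun e i => by rw [g.tgt_edge, f.tgt_edge]
      label_edge := fun e => by rw [g.label_edge, f.label_edge] }

theorem hom_ext {G H : Hyp S} {f g : G ⟶ H} (hn : ∀ v, f.node v = g.node v)
    (he : ∀ (k l : ℕ) (e : G.Edge k l), f.edge e = g.edge e) : f = g :=
  Hom.ext (funext hn) (by funext k l e; exact he k l e)

@[simp] theorem id_node (G : Hyp S) (v : G.Node) : Hom.node (𝟙 G) v = v := rfl

@[simp] theorem id_edge (G : Hyp S) {k l : ℕ} (e : G.Edge k l) : Hom.edge (𝟙 G) e = e := rfl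

@[simp] theorem comp_node {G H K : Hyp S} (f : G ⟶ H) (g : H ⟶ K) (v : G.Node) :
    (f ≫ g).node v = g.node (f.node v) := rfl

@[simp] theorem comp_edge {G H K : Hyp S} (f : G ⟶ H) (g : H ⟶ K) {k l : ℕ} (e : G.Edge k l) :
    (f ≫ g).edge e = g.edge (f.edge e) := rfl

/-- The discrete hypergraph with `n` nodes and no hyperedges. -/
def discrete (S : Signature.{u}) (n : ℕ) : Hyp S where
  Node := Fin n
  Edge _ _ := Empty
  finite_node := inferInstance
  finite_edge _ _ := inferInstance
  src e := e.elim
  tgt e := e.elim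
  label e := e.elim

/-- The homomorphism from a discrete hypergraph that is given on nodes by a function. -/
def ofFun {n : ℕ} {G : Hyp S} (f : Fin n → G.Node) : discrete S n ⟶ G where
  node := f
  edge e := e.elim
  src_edge e := e.elim
  tgt_edge e := e.elim
  label_edge e := e.elim

theorem discrete_hom_ext {n : ℕ} {G : Hyp S} {f g : discrete S n ⟶ G}
    (h : ∀ i : Fin n, f.node i = g.node i) : f = g :=
  hom_ext h fun _ _ e => e.elim

/-- The coproduct (disjoint union) of two hypergraphs. -/
def sum (G H : Hyp S) : Hyp S where
  Node := G.Node ⊕ H.Node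
  Edge k l := G.Edge k l ⊕ H.Edge k l
  finite_node := by
    have := G.finite_node; have := H.finite_node; infer_instance
  finite_edge k l := by
    have := G.finite_edge k l; have := H.finite_edge k l; infer_instance
  src e i := e.elim (fun e => .inl (G.src e i)) fun e => .inr (H.src e i)
  tgt e i := e.elim (fun e => .inl (G.tgt e i)) fun e => .inr (H.tgt e i)
  label e := e.elim G.label H.label

/-- The gluing of `G` and `H` along `f` and `g`: the disjoint union of `G` and `H` in which the
nodes `f i` and `g i` are identified for every `i`. This is the pushout of `f` and `g`, see
`Hyp.isPushout_glue`. -/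
def glue {n : ℕ} {G H : Hyp S} (f : discrete S n ⟶ G) (g : discrete S n ⟶ H) : Hyp S where
  Node := Quot fun x y : G.Node ⊕ H.Node =>
    ∃ i : Fin n, x = .inl (f.node i) ∧ y = .inr (g.node i)
  Edge k l := G.Edge k l ⊕ H.Edge k l
  finite_node := by
    have := G.finite_node; have := H.finite_node; infer_instance
  finite_edge k l := by
    have := G.finite_edge k l; have := H.finite_edge k l; infer_instance
  src e i := Quot.mk _ (e.elim (fun e => .inl (G.src e i)) fun e => .inr (H.src e i))
  tgt e i := Quot.mk _ (e.elim (fun e => .inl (G.tgt e i)) fun e => .inr (H.tgt e i))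
  label e := e.elim G.label H.label

/-- The left injection into the gluing. -/
def glueInl {n : ℕ} {G H : Hyp S} (f : discrete S n ⟶ G) (g : discrete S n ⟶ H) :
    G ⟶ glue f g where
  node v := Quot.mk _ (.inl v)
  edge e := .inl e
  src_edge _ _ := rfl
  tgt_edge _ _ := rfl
  label_edge _ := rfl

/-- The right injection into the gluing. -/
def glueInr {n : ℕ} {G H : Hyp S} (f : discrete S n ⟶ G) (g : discrete S n ⟶ H) :
    H ⟶ glue f g where
  node v := Quot.mk _ (.inr v)
  edge e := .inr e
  src_edge _ _ := rfl
  tgt_edge _ _ := rfl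
  label_edge _ := rfl

/-- The homomorphism out of the gluing that is induced by a commutative square. -/
def glueDesc {n : ℕ} {G H K : Hyp S} (f : discrete S n ⟶ G) (g : discrete S n ⟶ H)
    (a : G ⟶ K) (b : H ⟶ K) (h : f ≫ a = g ≫ b) : glue f g ⟶ K where
  node := Quot.lift (Sum.elim a.node b.node) (by
    rintro _ _ ⟨i, rfl, rfl⟩
    exact congrArg (fun p : discrete S n ⟶ K => p.node i) h)
  edge e := e.elim a.edge b.edge
  src_edge e i := by
    rcases e with e | e
    · exact a.src_edge e i
    · exact b.src_edge e i
  tgt_edge e i := by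
    rcases e with e | e
    · exact a.tgt_edge e i
    · exact b.tgt_edge e i
  label_edge e := by
    rcases e with e | e
    · exact a.label_edge e
    · exact b.label_edge e

theorem isPushout_glue {n : ℕ} {G H : Hyp S} (f : discrete S n ⟶ G) (g : discrete S n ⟶ H) :
    IsPushout f g (glueInl f g) (glueInr f g) := by
  have w : f ≫ glueInl f g = g ≫ glueInr f g :=
    discrete_hom_ext fun i => Quot.sound ⟨i, rfl, rfl⟩
  refine ⟨⟨w⟩, ⟨PushoutCocone.IsColimit.mk w (fun s => glueDesc f g s.inl s.inr s.condition)
    (fun _ => rfl) (fun _ => rfl) ?_⟩⟩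
  intro s m h1 h2
  refine hom_ext ?_ ?_
  · rintro ⟨v | v⟩
    · exact congrArg (fun p : G ⟶ s.pt => p.node v) h1
    · exact congrArg (fun p : H ⟶ s.pt => p.node v) h2
  · rintro k l (e | e)
    · exact congrArg (fun p : G ⟶ s.pt => p.edge e) h1
    · exact congrArg (fun p : H ⟶ s.pt => p.edge e) h2

/-- The left injection into the coproduct. -/
def sumInl (G H : Hyp S) : G ⟶ sum G H where
  node := .inl
  edge e := .inl e
  src_edge _ _ := rfl
  tgt_edge _ _ := rfl
  label_edge _ := rfl

/-- The right injection into the coproduct. -/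
def sumInr (G H : Hyp S) : H ⟶ sum G H where
  node := .inr
  edge e := .inr e
  src_edge _ _ := rfl
  tgt_edge _ _ := rfl
  label_edge _ := rfl

/-- The copairing out of the coproduct. -/
def sumDesc {G H K : Hyp S} (a : G ⟶ K) (b : H ⟶ K) : sum G H ⟶ K where
  node := Sum.elim a.node b.node
  edge e := e.elim a.edge b.edge
  src_edge e i := by
    rcases e with e | e
    · exact a.src_edge e i
    · exact b.src_edge e i
  tgt_edge e i := by
    rcases e with e | e
    · exact a.tgt_edge e i
    · exact b.tgt_edge e i
  label_edge e := by
    rcases e with e | e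
    · exact a.label_edge e
    · exact b.label_edge e

theorem sum_hom_ext {G H K : Hyp S} {f g : sum G H ⟶ K} (h1 : sumInl G H ≫ f = sumInl G H ≫ g)
    (h2 : sumInr G H ≫ f = sumInr G H ≫ g) : f = g := by
  refine hom_ext ?_ ?_
  · rintro (v | v)
    · exact congrArg (fun p : G ⟶ K => p.node v) h1
    · exact congrArg (fun p : H ⟶ K => p.node v) h2
  · rintro k l (e | e)
    · exact congrArg (fun p : G ⟶ K => p.edge e) h1
    · exact congrArg (fun p : H ⟶ K => p.edge e) h2

@[simp] theorem sumInl_desc {G H K : Hyp S} (a : G ⟶ K) (b : H ⟶ K) :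
    sumInl G H ≫ sumDesc a b = a := rfl

@[simp] theorem sumInr_desc {G H K : Hyp S} (a : G ⟶ K) (b : H ⟶ K) :
    sumInr G H ≫ sumDesc a b = b := rfl

@[simp] theorem sumInl_desc_assoc {G H K L : Hyp S} (a : G ⟶ K) (b : H ⟶ K) (c : K ⟶ L) :
    sumInl G H ≫ sumDesc a b ≫ c = a ≫ c := rfl

@[simp] theorem sumInr_desc_assoc {G H K L : Hyp S} (a : G ⟶ K) (b : H ⟶ K) (c : K ⟶ L) :
    sumInr G H ≫ sumDesc a b ≫ c = b ≫ c := rfl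

/-- The inclusion of the first `m` nodes. -/
def discreteInl (S : Signature.{u}) (m n : ℕ) : discrete S m ⟶ discrete S (m + n) :=
  ofFun (Fin.castAdd n)

/-- The inclusion of the last `n` nodes. -/
def discreteInr (S : Signature.{u}) (m n : ℕ) : discrete S n ⟶ discrete S (m + n) :=
  ofFun (Fin.natAdd m)

/-- The copairing out of `m + n`, seen as the coproduct of `m` and `n`. -/
def discreteDesc {m n : ℕ} {G : Hyp S} (f : discrete S m ⟶ G) (g : discrete S n ⟶ G) :
    discrete S (m + n) ⟶ G :=
  ofFun (Fin.addCases f.node g.node)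

@[simp] theorem discreteInl_desc {m n : ℕ} {G : Hyp S} (f : discrete S m ⟶ G)
    (g : discrete S n ⟶ G) : discreteInl S m n ≫ discreteDesc f g = f :=
  discrete_hom_ext fun i => Fin.addCases_left (motive := fun _ => G.Node) i

@[simp] theorem discreteInr_desc {m n : ℕ} {G : Hyp S} (f : discrete S m ⟶ G)
    (g : discrete S n ⟶ G) : discreteInr S m n ≫ discreteDesc f g = g :=
  discrete_hom_ext fun i => Fin.addCases_right (motive := fun _ => G.Node) i

@[simp] theorem discreteInl_desc_assoc {m n : ℕ} {G H : Hyp S} (f : discrete S m ⟶ G)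
    (g : discrete S n ⟶ G) (a : G ⟶ H) : discreteInl S m n ≫ discreteDesc f g ≫ a = f ≫ a := by
  rw [← Category.assoc, discreteInl_desc]

@[simp] theorem discreteInr_desc_assoc {m n : ℕ} {G H : Hyp S} (f : discrete S m ⟶ G)
    (g : discrete S n ⟶ G) (a : G ⟶ H) : discreteInr S m n ≫ discreteDesc f g ≫ a = g ≫ a := by
  rw [← Category.assoc, discreteInr_desc]

theorem discrete_add_hom_ext {m n : ℕ} {G : Hyp S} {f g : discrete S (m + n) ⟶ G}
    (h1 : discreteInl S m n ≫ f = discreteInl S m n ≫ g)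
    (h2 : discreteInr S m n ≫ f = discreteInr S m n ≫ g) : f = g := by
  refine discrete_hom_ext fun i => ?_
  refine Fin.addCases (fun j => ?_) (fun j => ?_) i
  · exact congrArg (fun p : discrete S m ⟶ G => p.node j) h1
  · exact congrArg (fun p : discrete S n ⟶ G => p.node j) h2

/-- The block transposition `n + m → m + n`. -/
def discreteSwap (S : Signature.{u}) (n m : ℕ) : discrete S (n + m) ⟶ discrete S (m + n) :=
  discreteDesc (discreteInr S m n) (discreteInl S m n)

/-- The relabelling of nodes along an equality of natural numbers. -/
def discreteCast (S : Signature.{u}) {n m : ℕ} (h : n = m) : discrete S n ⟶ discrete S m :=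
  ofFun (Fin.cast h)

end Hyp

/-! ### Cospans of hypergraphs with discrete interfaces -/

/-- A cospan `n → G ← m` of `S`-labelled hypergraphs with discrete interfaces. -/
structure Cospan (S : Signature.{u}) (n m : ℕ) where
  carrier : Hyp S
  left : Hyp.discrete S n ⟶ carrier
  right : Hyp.discrete S m ⟶ carrier

namespace Cospan

open Hyp

variable {S : Signature.{u}}

/-- Isomorphism of cospans. -/
def Isomorphic {n m : ℕ} (c d : Cospan S n m) : Prop :=
  ∃ α : c.carrier ≅ d.carrier, c.left ≫ α.hom = d.left ∧ c.right ≫ α.hom = d.right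

instance setoid (S : Signature.{u}) (n m : ℕ) : Setoid (Cospan S n m) where
  r := Isomorphic
  iseqv :=
    { refl := fun c => ⟨Iso.refl _, Category.comp_id _, Category.comp_id _⟩
      symm := by
        rintro c d ⟨α, h1, h2⟩
        exact ⟨α.symm, by simp [← h1], by simp [← h2]⟩
      trans := by
        rintro c d e ⟨α, h1, h2⟩ ⟨β, h3, h4⟩
        exact ⟨α ≪≫ β, by simp [← h3, ← h1], by simp [← h4, ← h2]⟩ }

/-- Composition of cospans, by pushout. -/
abbrev comp {n m k : ℕ} (c : Cospan S n m) (d : Cospan S m k) : Cospan S n k where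
  carrier := glue c.right d.left
  left := c.left ≫ glueInl c.right d.left
  right := d.right ≫ glueInr c.right d.left

/-- Monoidal product of cospans, by coproduct. -/
abbrev tensor {n m n' m' : ℕ} (c : Cospan S n m) (d : Cospan S n' m') :
    Cospan S (n + n') (m + m') where
  carrier := sum c.carrier d.carrier
  left := discreteDesc (c.left ≫ sumInl _ _) (d.left ≫ sumInr _ _)
  right := discreteDesc (c.right ≫ sumInl _ _) (d.right ≫ sumInr _ _)

/-- The cospan `a → a ← b` with identity left leg. -/
abbrev ofHom {a b : ℕ} (r : discrete S b ⟶ discrete S a) : Cospan S a b := ⟨discrete S a, 𝟙 _, r⟩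

/-- The identity cospan. -/
abbrev id (S : Signature.{u}) (n : ℕ) : Cospan S n n := ⟨discrete S n, 𝟙 _, 𝟙 _⟩

/-- The symmetry `m + n → n + m`. -/
abbrev symm (S : Signature.{u}) (m n : ℕ) : Cospan S (m + n) (n + m) :=
  ⟨discrete S (m + n), 𝟙 _, discreteSwap S n m⟩

theorem isomorphic_trans {n m : ℕ} {c d e : Cospan S n m} (h : Isomorphic c d)
    (h' : Isomorphic d e) : Isomorphic c e := (setoid S n m).iseqv.trans h h'

theorem isomorphic_symm {n m : ℕ} {c d : Cospan S n m} (h : Isomorphic c d) :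
    Isomorphic d c := (setoid S n m).iseqv.symm h

theorem comp_of_isPushout {n m k : ℕ} (c : Cospan S n m) (d : Cospan S m k) {X : Hyp S}
    {a : c.carrier ⟶ X} {b : d.carrier ⟶ X} (h : IsPushout c.right d.left a b) :
    Isomorphic (c.comp d) ⟨X, c.left ≫ a, d.right ≫ b⟩ :=
  ⟨(isPushout_glue c.right d.left).isoIsPushout _ _ h, by simp [comp], by simp [comp]⟩

theorem comp_congr {n m k : ℕ} {c c' : Cospan S n m} {d d' : Cospan S m k}
    (h : Isomorphic c c') (h' : Isomorphic d d') : Isomorphic (c.comp d) (c'.comp d') := by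
  obtain ⟨α, h1, h2⟩ := h
  obtain ⟨β, h3, h4⟩ := h'
  have hp : IsPushout c.right d.left (α.hom ≫ glueInl c'.right d'.left)
      (β.hom ≫ glueInr c'.right d'.left) :=
    IsPushout.of_iso (isPushout_glue c'.right d'.left) (Iso.refl _) α.symm β.symm (Iso.refl _)
      (by simp [← h2]) (by simp [← h3]) (by simp) (by simp)
  have := comp_of_isPushout c d hp
  rwa [← Category.assoc, ← Category.assoc, h1, h4] at this

theorem isomorphic_of {n m : ℕ} {c d : Cospan S n m} (a : c.carrier ⟶ d.carrier)
    (b : d.carrier ⟶ c.carrier) (hab : a ≫ b = 𝟙 _) (hba : b ≫ a = 𝟙 _)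
    (hl : c.left ≫ a = d.left) (hr : c.right ≫ a = d.right) : Isomorphic c d :=
  ⟨⟨a, b, hab, hba⟩, hl, hr⟩

/-- The map between coproducts that is induced by two maps. -/
def sumMap {G H G' H' : Hyp S} (a : G ⟶ G') (b : H ⟶ H') : sum G H ⟶ sum G' H' :=
  sumDesc (a ≫ sumInl _ _) (b ≫ sumInr _ _)

theorem discreteDesc_comp {m n : ℕ} {G H : Hyp S} (f : discrete S m ⟶ G)
    (g : discrete S n ⟶ G) (a : G ⟶ H) :
    discreteDesc f g ≫ a = discreteDesc (f ≫ a) (g ≫ a) := by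
  apply discrete_add_hom_ext
  · rw [← Category.assoc, discreteInl_desc, discreteInl_desc]
  · rw [← Category.assoc, discreteInr_desc, discreteInr_desc]

theorem tensor_congr {n m n' m' : ℕ} {c c' : Cospan S n m} {d d' : Cospan S n' m'}
    (h : Isomorphic c c') (h' : Isomorphic d d') : Isomorphic (c.tensor d) (c'.tensor d') := by
  obtain ⟨α, h1, h2⟩ := h
  obtain ⟨β, h3, h4⟩ := h'
  refine isomorphic_of (sumMap α.hom β.hom) (sumMap α.inv β.inv) ?_ ?_ ?_ ?_
  · apply sum_hom_ext <;> simp [sumMap]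
  · apply sum_hom_ext <;> simp [sumMap]
  · simp only [tensor, discreteDesc_comp, Category.assoc, sumMap, sumInl_desc, sumInr_desc]
    simp only [← Category.assoc, h1, h3]
  · simp only [tensor, discreteDesc_comp, Category.assoc, sumMap, sumInl_desc, sumInr_desc]
    simp only [← Category.assoc, h2, h4]

theorem comp_ofHom {n m k : ℕ} (c : Cospan S n m) (r : discrete S k ⟶ discrete S m) :
    Isomorphic (c.comp (ofHom r)) ⟨c.carrier, c.left, r ≫ c.right⟩ := by
  have hp : IsPushout c.right (𝟙 (discrete S m)) (𝟙 _) c.right := IsPushout.of_vert_isIso ⟨by simp⟩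
  have := comp_of_isPushout c (ofHom r) hp
  rwa [Category.comp_id] at this

theorem ofHom_comp {n m k : ℕ} (r : discrete S m ⟶ discrete S n)
    (r' : discrete S n ⟶ discrete S m) (h1 : r ≫ r' = 𝟙 _) (h2 : r' ≫ r = 𝟙 _)
    (c : Cospan S m k) :
    Isomorphic ((ofHom r).comp c) ⟨c.carrier, r' ≫ c.left, c.right⟩ := by
  have : IsIso r := ⟨r', h1, h2⟩
  have hp : IsPushout r c.left (r' ≫ c.left) (𝟙 _) :=
    IsPushout.of_horiz_isIso ⟨by rw [← Category.assoc, h1]; simp⟩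
  have := comp_of_isPushout (ofHom r) c hp
  rw [Category.comp_id] at this
  rwa [Category.id_comp] at this

theorem tensor_ofHom {a b a' b' : ℕ} (r : discrete S b ⟶ discrete S a)
    (r' : discrete S b' ⟶ discrete S a') :
    Isomorphic ((ofHom r).tensor (ofHom r'))
      (ofHom (discreteDesc (r ≫ discreteInl S a a') (r' ≫ discreteInr S a a'))) := by
  refine isomorphic_of (sumDesc (discreteInl S a a') (discreteInr S a a'))
    (discreteDesc (sumInl _ _) (sumInr _ _)) ?_ ?_ ?_ ?_
  · apply sum_hom_ext <;> simp
  · apply discrete_add_hom_ext <;> simp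
  · apply discrete_add_hom_ext <;> simp
  · simp [discreteDesc_comp]

theorem discreteSwap_swap (m n : ℕ) : discreteSwap S m n ≫ discreteSwap S n m = 𝟙 _ := by
  apply discrete_add_hom_ext <;> simp [discreteSwap]

theorem mk_castHom {n m n' m' : ℕ} (hn : n = n') (hm : m = m') (c : Cospan S n m) :
    castHom (H := fun a b => Quotient (setoid S a b)) hn hm (Quotient.mk _ c) =
      Quotient.mk _ ⟨c.carrier, discreteCast S hn.symm ≫ c.left,
        discreteCast S hm.symm ≫ c.right⟩ := by
  subst hn hm
  have e : ∀ (k : ℕ) (h : k = k), discreteCast S h = 𝟙 _ := fun _ _ =>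
    discrete_hom_ext fun _ => rfl
  simp only [e, Category.id_comp]
  rfl

theorem comp_assoc {a b c d : ℕ} (s : Cospan S a b) (t : Cospan S b c) (r : Cospan S c d) :
    Isomorphic ((s.comp t).comp r) (s.comp (t.comp r)) := by
  have h1 := isPushout_glue s.right t.left
  have h2 := isPushout_glue t.right r.left
  have h4 : IsPushout (t.right ≫ glueInr s.right t.left) r.left
    (glueInl (s.comp t).right r.left) (glueInr (s.comp t).right r.left) :=
    isPushout_glue (s.comp t).right r.left
  have w : t.right ≫ (glueInr s.right t.left ≫ glueInl (s.comp t).right r.left) =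
      r.left ≫ glueInr (s.comp t).right r.left := by rw [← h4.w, Category.assoc]
  have h5 : IsPushout (glueInr s.right t.left) (glueInl t.right r.left)
      (glueInl (s.comp t).right r.left) (h2.desc _ _ w) :=
    IsPushout.of_left (by rw [h2.inr_desc]; exact h4) (h2.inl_desc _ _ w).symm h2
  have h6 := h1.flip.paste_horiz h5.flip
  have h7 := isomorphic_symm (comp_of_isPushout s (t.comp r) h6.flip)
  have e : (s.comp t).comp r = ⟨glue (s.comp t).right r.left,
      s.left ≫ (glueInl s.right t.left ≫ glueInl (s.comp t).right r.left),
      (t.comp r).right ≫ h2.desc _ _ w⟩ := by simp [comp]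
  rw [e]
  exact h7

theorem tensor_assoc {a b a' b' a'' b'' : ℕ}
    (s : Cospan S a b) (t : Cospan S a' b') (r : Cospan S a'' b'') :
    Isomorphic ⟨((s.tensor t).tensor r).carrier,
      discreteCast S (Nat.add_assoc a a' a'').symm ≫ ((s.tensor t).tensor r).left,
      discreteCast S (Nat.add_assoc b b' b'').symm ≫ ((s.tensor t).tensor r).right⟩
      (s.tensor (t.tensor r)) := by
  have key : ∀ (n n' n'' : ℕ) (f : discrete S n ⟶ s.carrier) (f' : discrete S n' ⟶ t.carrier)
      (f'' : discrete S n'' ⟶ r.carrier),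
      (discreteCast S (Nat.add_assoc n n' n'').symm ≫
        discreteDesc (discreteDesc (f ≫ sumInl _ _) (f' ≫ sumInr _ _) ≫ sumInl _ _)
          (f'' ≫ sumInr _ _)) ≫
        sumDesc (sumDesc (sumInl s.carrier (sum t.carrier r.carrier))
          (sumInl t.carrier r.carrier ≫ sumInr _ _)) (sumInr _ _ ≫ sumInr _ _) =
      discreteDesc (f ≫ sumInl _ _)
        (discreteDesc (f' ≫ sumInl _ _) (f'' ≫ sumInr _ _) ≫ sumInr _ _) := by
    intro n n' n'' f f' f''
    have e1 : discreteInl S n (n' + n'') ≫ discreteCast S (Nat.add_assoc n n' n'').symm =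
        discreteInl S n n' ≫ discreteInl S (n + n') n'' :=
      discrete_hom_ext fun i => Fin.ext rfl
    have e2 : discreteInl S n' n'' ≫ discreteInr S n (n' + n'') ≫
        discreteCast S (Nat.add_assoc n n' n'').symm =
        discreteInr S n n' ≫ discreteInl S (n + n') n'' :=
      discrete_hom_ext fun i => Fin.ext rfl
    have e3 : discreteInr S n' n'' ≫ discreteInr S n (n' + n'') ≫
        discreteCast S (Nat.add_assoc n n' n'').symm = discreteInr S (n + n') n'' :=
      discrete_hom_ext fun i => Fin.ext (Nat.add_assoc n n' i).symm
    apply discrete_add_hom_ext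
    · rw [← Category.assoc, ← Category.assoc, e1]
      simp [discreteDesc_comp]
    · apply discrete_add_hom_ext
      · rw [← Category.assoc, ← Category.assoc, ← Category.assoc, ← Category.assoc,
          Category.assoc (discreteInl S n' n''), e2]
        simp [discreteDesc_comp]
      · rw [← Category.assoc, ← Category.assoc, ← Category.assoc, ← Category.assoc,
          Category.assoc (discreteInr S n' n''), e3]
        simp [discreteDesc_comp]
  refine isomorphic_of (sumDesc (sumDesc (sumInl s.carrier (sum t.carrier r.carrier))
          (sumInl t.carrier r.carrier ≫ sumInr _ _)) (sumInr _ _ ≫ sumInr _ _))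
    (sumDesc (sumInl _ _ ≫ sumInl _ _) (sumDesc (sumInr _ _ ≫ sumInl _ _) (sumInr _ _)))
    ?_ ?_ (key _ _ _ _ _ _) (key _ _ _ _ _ _)
  · refine sum_hom_ext (sum_hom_ext ?_ ?_) ?_ <;> rfl
  · refine sum_hom_ext ?_ (sum_hom_ext ?_ ?_) <;> rfl

theorem id_tensor {a b : ℕ} (s : Cospan S a b) :
    Isomorphic ⟨((id S 0).tensor s).carrier,
      discreteCast S (Nat.zero_add a).symm ≫ ((id S 0).tensor s).left,
      discreteCast S (Nat.zero_add b).symm ≫ ((id S 0).tensor s).right⟩ s := by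
  have key : ∀ (n : ℕ) (f : discrete S n ⟶ s.carrier),
      (discreteCast S (Nat.zero_add n).symm ≫
        discreteDesc (𝟙 (discrete S 0) ≫ sumInl _ _) (f ≫ sumInr _ _)) ≫
        sumDesc (ofFun (fun i : Fin 0 => i.elim0)) (𝟙 _) = f := by
    intro n f
    have e : discreteCast S (Nat.zero_add n).symm = discreteInr S 0 n :=
      discrete_hom_ext fun i => Fin.ext (Nat.zero_add _).symm
    rw [e]; simp
  refine isomorphic_of (sumDesc (ofFun (fun i : Fin 0 => i.elim0)) (𝟙 _)) (sumInr _ _)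
    ?_ ?_ (key _ _) (key _ _)
  · exact sum_hom_ext (discrete_hom_ext fun i => i.elim0) rfl
  · rfl

theorem tensor_id {a b : ℕ} (s : Cospan S a b) : Isomorphic (s.tensor (id S 0)) s := by
  have key : ∀ (n : ℕ) (f : discrete S n ⟶ s.carrier),
      discreteDesc (f ≫ sumInl _ _) (𝟙 (discrete S 0) ≫ sumInr _ _) ≫
        sumDesc (𝟙 _) (ofFun (fun i : Fin 0 => i.elim0)) = f := by
    intro n f
    have e : ∀ (x : discrete S n ⟶ s.carrier) (y : discrete S 0 ⟶ s.carrier),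
        discreteDesc x y = x := fun x y =>
      discrete_hom_ext fun i =>
        Fin.addCases_left (motive := fun _ => s.carrier.Node) (n := 0) i
    rw [discreteDesc_comp]
    exact e _ _
  refine isomorphic_of (sumDesc (𝟙 _) (ofFun (fun i : Fin 0 => i.elim0))) (sumInl _ _)
    ?_ ?_ (key _ _) (key _ _)
  · exact sum_hom_ext rfl (discrete_hom_ext fun i => i.elim0)
  · rfl

theorem interchange {a b c a' b' c' : ℕ}
    (s : Cospan S a b) (r : Cospan S b c) (t : Cospan S a' b') (v : Cospan S b' c') :
    Isomorphic ((s.comp r).tensor (t.comp v)) ((s.tensor t).comp (r.tensor v)) := by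
  have h1 := isPushout_glue s.right r.left
  have h2 := isPushout_glue t.right v.left
  have hp : IsPushout (s.tensor t).right (r.tensor v).left
      (sumMap (glueInl s.right r.left) (glueInl t.right v.left))
      (sumMap (glueInr s.right r.left) (glueInr t.right v.left)) := by
    have w : (s.tensor t).right ≫ sumMap (glueInl s.right r.left) (glueInl t.right v.left) =
        (r.tensor v).left ≫ sumMap (glueInr s.right r.left) (glueInr t.right v.left) := by
      simp only [tensor, sumMap, discreteDesc_comp, Category.assoc, sumInl_desc, sumInr_desc]
      rw [← Category.assoc, ← Category.assoc, ← Category.assoc, ← Category.assoc, h1.w, h2.w]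
    refine ⟨⟨w⟩, ⟨PushoutCocone.IsColimit.mk w (fun q => sumDesc
      (glueDesc _ _ (sumInl _ _ ≫ q.inl) (sumInl _ _ ≫ q.inr) ?_)
      (glueDesc _ _ (sumInr _ _ ≫ q.inl) (sumInr _ _ ≫ q.inr) ?_)) ?_ ?_ ?_⟩⟩
    · have := congrArg (fun p => discreteInl S b b' ≫ p) q.condition
      simpa [← Category.assoc, tensor] using this
    · have := congrArg (fun p => discreteInr S b b' ≫ p) q.condition
      simpa [← Category.assoc, tensor] using this
    · intro q; exact sum_hom_ext rfl rfl
    · intro q; exact sum_hom_ext rfl rfl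
    · intro q m hm1 hm2
      refine sum_hom_ext (h1.hom_ext ?_ ?_) (h2.hom_ext ?_ ?_)
      · exact congrArg (fun p => sumInl _ _ ≫ p) hm1
      · exact congrArg (fun p => sumInl _ _ ≫ p) hm2
      · exact congrArg (fun p => sumInr _ _ ≫ p) hm1
      · exact congrArg (fun p => sumInr _ _ ≫ p) hm2
  have := isomorphic_symm (comp_of_isPushout _ _ hp)
  have e : (s.comp r).tensor (t.comp v) = ⟨sum (s.comp r).carrier (t.comp v).carrier,
      (s.tensor t).left ≫ sumMap (glueInl s.right r.left) (glueInl t.right v.left),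
      (r.tensor v).right ≫ sumMap (glueInr s.right r.left) (glueInr t.right v.left)⟩ := by
    simp [tensor, sumMap, discreteDesc_comp]
  rw [e]
  exact this

theorem id_tensor_id (m n : ℕ) : Isomorphic ((id S m).tensor (id S n)) (id S (m + n)) := by
  have h := tensor_ofHom (𝟙 (discrete S m)) (𝟙 (discrete S n))
  have e : discreteDesc (𝟙 _ ≫ discreteInl S m n) (𝟙 _ ≫ discreteInr S m n) = 𝟙 _ := by
    apply discrete_add_hom_ext <;> simp
  rw [e] at h
  exact h

theorem id_comp {a b : ℕ} (s : Cospan S a b) : Isomorphic ((id S a).comp s) s := by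
  have := ofHom_comp (𝟙 _) (𝟙 _) (Category.comp_id _) (Category.comp_id _) s
  rwa [Category.id_comp] at this

theorem comp_id {a b : ℕ} (s : Cospan S a b) : Isomorphic (s.comp (id S b)) s := by
  have := comp_ofHom s (𝟙 _)
  rwa [Category.id_comp] at this

theorem symm_symm (m n : ℕ) :
    Isomorphic ((symm S m n).comp (symm S n m)) (id S (m + n)) := by
  have := comp_ofHom (symm S m n) (discreteSwap S m n)
  rw [show discreteSwap S m n ≫ (symm S m n).right = 𝟙 _ from discreteSwap_swap m n] at this
  exact this

theorem symm_natural {a b : ℕ} (s : Cospan S a b) (m : ℕ) :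
    Isomorphic ((s.tensor (id S m)).comp (symm S b m))
      ((symm S a m).comp ((id S m).tensor s)) := by
  refine isomorphic_trans (comp_ofHom _ (discreteSwap S m b)) (isomorphic_trans ?_
    (isomorphic_symm (ofHom_comp (discreteSwap S m a) (discreteSwap S a m)
      (discreteSwap_swap _ _) (discreteSwap_swap _ _) _)))
  refine isomorphic_of (sumDesc (sumInr _ _) (sumInl _ _)) (sumDesc (sumInr _ _) (sumInl _ _))
    (sum_hom_ext rfl rfl) (sum_hom_ext rfl rfl) ?_ ?_
  · apply discrete_add_hom_ext <;>
      simp [tensor, id, discreteSwap, discreteDesc_comp]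
  · apply discrete_add_hom_ext <;>
      simp [tensor, id, discreteSwap, discreteDesc_comp]

/-- Reindexing of the interfaces of a cospan. -/
abbrev reindex {n m n' m' : ℕ} (c : Cospan S n m) (x : discrete S n' ⟶ discrete S n)
    (y : discrete S m' ⟶ discrete S m) : Cospan S n' m' :=
  ⟨c.carrier, x ≫ c.left, y ≫ c.right⟩

theorem reindex_congr {n m n' m' : ℕ} {c d : Cospan S n m} (h : Isomorphic c d)
    (x : discrete S n' ⟶ discrete S n) (y : discrete S m' ⟶ discrete S m) :
    Isomorphic (c.reindex x y) (d.reindex x y) := by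
  obtain ⟨α, h1, h2⟩ := h
  exact ⟨α, by simp [← h1], by simp [← h2]⟩

theorem reindex_ofHom {n m n' m' : ℕ} (r : discrete S m ⟶ discrete S n) (hn : n = n')
    (hm : m = m') :
    Isomorphic ((ofHom r).reindex (discreteCast S hn.symm) (discreteCast S hm.symm))
      (ofHom (discreteCast S hm.symm ≫ r ≫ discreteCast S hn)) := by
  refine isomorphic_of (discreteCast S hn) (discreteCast S hn.symm)
    (discrete_hom_ext fun _ => rfl) (discrete_hom_ext fun _ => rfl) ?_ ?_
  · exact discrete_hom_ext fun _ => rfl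
  · simp

theorem symm_hexagon (m n o : ℕ) :
    Isomorphic
      ((((symm S m n).tensor (id S o)).comp
        (((id S n).tensor (symm S m o)).reindex (discreteCast S (Nat.add_assoc n m o))
          (discreteCast S rfl))).reindex
        (discreteCast S (Nat.add_assoc m n o).symm) (discreteCast S (Nat.add_assoc n o m)))
      (symm S m (n + o)) := by
  have h1 := tensor_ofHom (discreteSwap S n m) (𝟙 (discrete S o))
  have h2 := isomorphic_trans
    (reindex_congr (tensor_ofHom (𝟙 (discrete S n)) (discreteSwap S o m))
      (discreteCast S (Nat.add_assoc n m o)) (discreteCast S rfl))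
    (reindex_ofHom _ (Nat.add_assoc n m o).symm rfl)
  have h3 := isomorphic_trans (comp_congr h1 h2) (comp_ofHom _ _)
  refine isomorphic_trans (isomorphic_trans (reindex_congr h3 _ _)
    (reindex_ofHom _ (Nat.add_assoc m n o) (Nat.add_assoc n o m).symm)) ?_
  rw [show symm S m (n + o) = ofHom (discreteSwap S (n + o) m) from rfl]
  suffices e : ∀ x y : discrete S (n + o + m) ⟶ discrete S (m + (n + o)), x = y →
      Isomorphic (ofHom x) (ofHom y) by
    apply e
    have e1 : ∀ a b c (G : Hyp S) (g : discrete S (a + (b + c)) ⟶ G),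
        discreteInl S a b ≫ discreteInl S (a + b) c ≫ discreteCast S (Nat.add_assoc a b c) ≫ g =
          discreteInl S a (b + c) ≫ g :=
      fun _ _ _ _ _ => discrete_hom_ext fun i => rfl
    have e2 : ∀ a b c (G : Hyp S) (g : discrete S (a + (b + c)) ⟶ G),
        discreteInr S a b ≫ discreteInl S (a + b) c ≫ discreteCast S (Nat.add_assoc a b c) ≫ g =
          discreteInl S b c ≫ discreteInr S a (b + c) ≫ g :=
      fun _ _ _ _ _ => discrete_hom_ext fun i => rfl
    have e3 : ∀ a b c (G : Hyp S) (g : discrete S (a + (b + c)) ⟶ G),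
        discreteInr S (a + b) c ≫ discreteCast S (Nat.add_assoc a b c) ≫ g =
          discreteInr S b c ≫ discreteInr S a (b + c) ≫ g :=
      fun a b c _ g => discrete_hom_ext fun i =>
        congrArg g.node (Fin.ext (Nat.add_assoc a b i))
    have f1 : ∀ a b c (G : Hyp S) (g : discrete S (a + b + c) ⟶ G),
        discreteInl S a (b + c) ≫ discreteCast S (Nat.add_assoc a b c).symm ≫ g =
          discreteInl S a b ≫ discreteInl S (a + b) c ≫ g :=
      fun _ _ _ _ _ => discrete_hom_ext fun i => rfl
    have f2 : ∀ a b c (G : Hyp S) (g : discrete S (a + b + c) ⟶ G),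
        discreteInl S b c ≫ discreteInr S a (b + c) ≫
          discreteCast S (Nat.add_assoc a b c).symm ≫ g =
          discreteInr S a b ≫ discreteInl S (a + b) c ≫ g :=
      fun _ _ _ _ _ => discrete_hom_ext fun i => rfl
    have f3 : ∀ a b c (G : Hyp S) (g : discrete S (a + b + c) ⟶ G),
        discreteInr S b c ≫ discreteInr S a (b + c) ≫
          discreteCast S (Nat.add_assoc a b c).symm ≫ g = discreteInr S (a + b) c ≫ g :=
      fun a b c _ g => discrete_hom_ext fun i =>
        congrArg g.node (Fin.ext (Nat.add_assoc a b i).symm)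
    have e1' := fun a b c => e1 a b c _ (𝟙 _)
    have e2' := fun a b c => e2 a b c _ (𝟙 _)
    have e3' := fun a b c => e3 a b c _ (𝟙 _)
    have c0 : discreteCast S (rfl : n + (o + m) = n + (o + m)) = 𝟙 _ :=
      discrete_hom_ext fun _ => rfl
    simp only [Category.comp_id] at e1' e2' e3'
    apply discrete_add_hom_ext
    · apply discrete_add_hom_ext <;>
        simp [discreteSwap, discreteDesc_comp, e1, e2, e1', e2', e3', f1, f2, f3, c0]
    · simp [discreteSwap, discreteDesc_comp, e3, e1', e2', e3', f1, f2, f3, c0]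
  rintro x _ rfl
  exact (setoid S _ _).iseqv.refl _

end Cospan

/-- The PROP of cospans of `S`-labelled hypergraphs with discrete interfaces, up to isomorphism of
cospans. -/
def Csp (S : Signature.{u}) : PROP.{max 1 u} where
  Hom n m := Quotient (Cospan.setoid S n m)
  id n := Quotient.mk _ (Cospan.id S n)
  comp := Quotient.map₂ Cospan.comp fun _ _ h _ _ h' => Cospan.comp_congr h h'
  tensor := Quotient.map₂ Cospan.tensor fun _ _ h _ _ h' => Cospan.tensor_congr h h'
  symm m n := Quotient.mk _ (Cospan.symm S m n)
  comp_assoc s t r := by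
    induction s using Quotient.inductionOn
    induction t using Quotient.inductionOn
    induction r using Quotient.inductionOn
    exact Quotient.sound (Cospan.comp_assoc _ _ _)
  id_comp s := by
    induction s using Quotient.inductionOn
    exact Quotient.sound (Cospan.id_comp _)
  comp_id s := by
    induction s using Quotient.inductionOn
    exact Quotient.sound (Cospan.comp_id _)
  tensor_assoc s t r := by
    induction s using Quotient.inductionOn
    induction t using Quotient.inductionOn
    induction r using Quotient.inductionOn
    exact (Cospan.mk_castHom _ _ _).trans (Quotient.sound (Cospan.tensor_assoc _ _ _))
  id_tensor s := by
    induction s using Quotient.inductionOn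
    exact (Cospan.mk_castHom _ _ _).trans (Quotient.sound (Cospan.id_tensor _))
  tensor_id s := by
    induction s using Quotient.inductionOn
    exact Quotient.sound (Cospan.tensor_id _)
  interchange s r t v := by
    induction s using Quotient.inductionOn
    induction r using Quotient.inductionOn
    induction t using Quotient.inductionOn
    induction v using Quotient.inductionOn
    exact Quotient.sound (Cospan.interchange _ _ _ _)
  id_tensor_id m n := Quotient.sound (Cospan.id_tensor_id m n)
  symm_hexagon m n o := by
    simp only [Quotient.map₂_mk]
    rw [Cospan.mk_castHom]
    exact (Cospan.mk_castHom _ _ _).trans (Quotient.sound (Cospan.symm_hexagon m n o))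
  symm_symm m n := Quotient.sound (Cospan.symm_symm m n)
  symm_natural s m := by
    induction s using Quotient.inductionOn
    exact Quotient.sound (Cospan.symm_natural _ m)

/-! ### The interpretation of string diagrams as cospans of hypergraphs -/

/-- A one-element family concentrated in bidegree `(k, l)`. -/
inductive SingleEdge (k l : ℕ) : ℕ → ℕ → Type
  | edge : SingleEdge k l k l

/-- The cospan `k → G ← l` of an operation `o` of arity `k` and coarity `l`: `G` consists of a
single hyperedge labelled by `o`, with `k` source nodes and `l` target nodes, all distinct. The
left leg picks out the source nodes and the right leg picks out the target nodes, in order. -/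
def Cospan.ofOp {S : Signature.{u}} {k l : ℕ} (o : S.Op k l) : Cospan S k l where
  carrier :=
    { Node := Fin k ⊕ Fin l
      Edge := SingleEdge k l
      finite_node := inferInstance
      finite_edge := fun k' l' => by
        have : Subsingleton (SingleEdge k l k' l') := ⟨by rintro ⟨⟩ ⟨⟩; rfl⟩
        infer_instance
      src := fun e i => match e, i with | .edge, i => .inl i
      tgt := fun e i => match e, i with | .edge, i => .inr i
      label := fun e => match e with | .edge => o }
  left := Hyp.ofFun .inl
  right := Hyp.ofFun .inr

/-- The interpretation `Syn(S) → Csp(Hyp_S)`: the PROP morphism that sends each generator `o` to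
the cospan `Cospan.ofOp o`. -/
def interpretation (S : Signature.{u}) : (Syn S).Morphism (Csp S) :=
  Syn.lift (Csp S) fun o => Quotient.mk _ (Cospan.ofOp o)

/-! ### Monogamy and acyclicity -/

namespace Hyp

variable {S : Signature.{u}} (G : Hyp S)

/-- The hyperedges of all arities and coarities. -/
def Hyperedge := Σ k l : ℕ, G.Edge k l

variable {G}

/-- The set of source nodes of a hyperedge. -/
def sources (h : G.Hyperedge) : Set G.Node := Set.range (G.src h.2.2)

/-- The set of target nodes of a hyperedge. -/
def targets (h : G.Hyperedge) : Set G.Node := Set.range (G.tgt h.2.2)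

/-- The number of pairs `(h, i)` such that `v` is the `i`-th target of `h`. -/
noncomputable def inDegree (v : G.Node) : ℕ∞ :=
  {p : Σ h : G.Hyperedge, Fin h.2.1 | G.tgt p.1.2.2 p.2 = v}.encard

/-- The number of pairs `(h, j)` such that `v` is the `j`-th source of `h`. -/
noncomputable def outDegree (v : G.Node) : ℕ∞ :=
  {p : Σ h : G.Hyperedge, Fin h.1 | G.src p.1.2.2 p.2 = v}.encard

/-- `h` is a predecessor of `h'`, i.e. `h'` is a successor of `h`. -/
def IsPredecessor (h h' : G.Hyperedge) : Prop := ∃ v, v ∈ targets h ∧ v ∈ sources h'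

/-- `p` is a path from the hyperedge `h` to the hyperedge `h'`. -/
def IsPath (p : List G.Hyperedge) (h h' : G.Hyperedge) : Prop :=
  p.head? = some h ∧ p.getLast? = some h' ∧ p.IsChain IsPredecessor

/-- `p` is a path from the node `v` to the node `w`. -/
def IsNodePath (p : List G.Hyperedge) (v w : G.Node) : Prop :=
  ∃ h h' : G.Hyperedge, IsPath p h h' ∧ v ∈ sources h ∧ w ∈ targets h'

variable (G) in
/-- There is no path from a node to itself. -/
def Acyclic : Prop := ∀ (v : G.Node) (p : List G.Hyperedge), ¬ IsNodePath p v v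

end Hyp

namespace Cospan

variable {S : Signature.{u}} {n m : ℕ} (c : Cospan S n m)

/-- The input nodes: the image of the left leg. -/
def inputs : Set c.carrier.Node := Set.range c.left.node

/-- The output nodes: the image of the right leg. -/
def outputs : Set c.carrier.Node := Set.range c.right.node

/-- Both legs are monomorphisms, inputs have in-degree `0`, outputs have out-degree `0`, and all
other in-degrees and out-degrees are `1`. -/
structure Monogamous : Prop where
  mono_left : Mono c.left
  mono_right : Mono c.right
  inDegree_of_mem : ∀ v ∈ c.inputs, Hyp.inDegree v = 0
  inDegree_of_notMem : ∀ v ∉ c.inputs, Hyp.inDegree v = 1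
  outDegree_of_mem : ∀ v ∈ c.outputs, Hyp.outDegree v = 0
  outDegree_of_notMem : ∀ v ∉ c.outputs, Hyp.outDegree v = 1

/-- The carrier is acyclic. -/
def Acyclic : Prop := c.carrier.Acyclic

end Cospan

end StringDiagram

namespace StringDiagram

/-! ### Bijectivity of copairings -/

theorem bijective_sumElim_iff {I T A : Type*} (f : I → A) (t : T → A) :
    Function.Bijective (Sum.elim f t) ↔ Function.Injective f ∧
      (∀ v ∈ Set.range f, {p | t p = v}.encard = 0) ∧
        ∀ v ∉ Set.range f, {p | t p = v}.encard = 1 := by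
  simp only [Set.encard_eq_zero, Set.encard_eq_one, Set.eq_empty_iff_forall_notMem,
    Set.mem_ofPred_eq]
  constructor
  · rintro ⟨hi, hs⟩
    rw [Sum.elim_injective] at hi
    refine ⟨hi.1, ?_, ?_⟩
    · rintro _ ⟨i, rfl⟩ p hp
      exact hi.2.2 i p hp.symm
    · intro v hv
      obtain ⟨i | p, rfl⟩ := hs v
      · exact (hv ⟨i, rfl⟩).elim
      · exact ⟨p, Set.ext fun q => ⟨fun h => hi.2.1 h, fun h => congrArg t h⟩⟩
  · rintro ⟨hf, h0, h1⟩
    have hd : ∀ i p, f i ≠ t p := fun i p h => h0 _ ⟨i, rfl⟩ p h.symm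
    refine ⟨Sum.elim_injective.2 ⟨hf, fun p q hpq => ?_, hd⟩, fun v => ?_⟩
    · obtain ⟨r, hr⟩ := h1 (t q) (by rintro ⟨i, hi⟩; exact hd i q hi)
      have hp : p ∈ ({r} : Set T) := hr ▸ (hpq : p ∈ {p | t p = t q})
      have hq : q ∈ ({r} : Set T) := hr ▸ (rfl : t q = t q)
      exact hp.trans hq.symm
    · by_cases hv : v ∈ Set.range f
      · obtain ⟨i, rfl⟩ := hv
        exact ⟨.inl i, rfl⟩
      · obtain ⟨r, hr⟩ := h1 v hv
        have : r ∈ {p | t p = v} := hr ▸ rfl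
        exact ⟨.inr r, this⟩

section Glue

variable {I A B T : Type*} (f : I → A) (g : I → B)

/-- The relation that identifies `f i` in `A` with `g i` in `B`. -/
abbrev GlueRel (x y : A ⊕ B) : Prop := ∃ i, x = .inl (f i) ∧ y = .inr (g i)

theorem bijective_glue_right {t : T → B} (h : Function.Bijective (Sum.elim g t)) :
    Function.Bijective (Sum.elim (fun a => Quot.mk (GlueRel f g) (.inl a))
      fun p => Quot.mk (GlueRel f g) (.inr (t p))) := by
  let e := Equiv.ofBijective _ h
  have eg : ∀ i, e.symm (g i) = .inl i := fun i => e.symm_apply_apply (.inl i)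
  have et : ∀ i, e.symm (t i) = .inr i := fun i => e.symm_apply_apply (.inr i)
  let r : Quot (GlueRel f g) → A ⊕ T := Quot.lift
    (Sum.elim .inl fun b => (e.symm b).elim (fun i => .inl (f i)) .inr)
    (by rintro _ _ ⟨i, rfl, rfl⟩; simp [eg])
  refine ⟨Function.LeftInverse.injective (g := r) ?_, ?_⟩
  · rintro (a | p)
    · rfl
    · simp [r, et]
  · rintro ⟨a | b⟩
    · exact ⟨.inl a, rfl⟩
    · obtain ⟨i | p, rfl⟩ := h.2 b
      · exact ⟨.inl (f i), Quot.sound ⟨i, rfl, rfl⟩⟩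
      · exact ⟨.inr p, rfl⟩

theorem bijective_glue_left {t : T → A} (h : Function.Bijective (Sum.elim f t)) :
    Function.Bijective (Sum.elim (fun b => Quot.mk (GlueRel f g) (.inr b))
      fun p => Quot.mk (GlueRel f g) (.inl (t p))) := by
  let e := Equiv.ofBijective _ h
  have ef : ∀ i, e.symm (f i) = .inl i := fun i => e.symm_apply_apply (.inl i)
  have et : ∀ i, e.symm (t i) = .inr i := fun i => e.symm_apply_apply (.inr i)
  let r : Quot (GlueRel f g) → B ⊕ T := Quot.lift
    (Sum.elim (fun a => (e.symm a).elim (fun i => .inl (g i)) .inr) .inl)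
    (by rintro _ _ ⟨i, rfl, rfl⟩; simp [ef])
  refine ⟨Function.LeftInverse.injective (g := r) ?_, ?_⟩
  · rintro (b | p)
    · rfl
    · simp [r, et]
  · rintro ⟨a | b⟩
    · obtain ⟨i | p, rfl⟩ := h.2 a
      · exact ⟨.inl (g i), (Quot.sound ⟨i, rfl, rfl⟩).symm⟩
      · exact ⟨.inr p, rfl⟩
    · exact ⟨.inl b, rfl⟩

end Glue

namespace Hyp

variable {S : Signature.{u}}

theorem mono_iff_injective_node {n : ℕ} {G : Hyp S} (f : discrete S n ⟶ G) :
    Mono f ↔ Function.Injective f.node := by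
  constructor
  · intro _ i j hij
    have : ofFun (G := discrete S n) (fun _ : Fin 1 => i) = ofFun fun _ => j :=
      (cancel_mono f).1 (discrete_hom_ext fun _ => hij)
    exact congrArg (fun p : discrete S 1 ⟶ discrete S n => p.node (0 : Fin 1)) this
  · refine fun hf => ⟨fun a b hab => hom_ext (fun v => hf ?_) fun _ _ e => (a.edge e).elim⟩
    exact congrArg (fun p => Hom.node p v) hab

/-- The source positions of all hyperedges. -/
abbrev SrcPort (G : Hyp S) := Σ h : G.Hyperedge, Fin h.1

/-- The target positions of all hyperedges. -/
abbrev TgtPort (G : Hyp S) := Σ h : G.Hyperedge, Fin h.2.1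

/-- The node at a source position. -/
def srcPort {G : Hyp S} (p : G.SrcPort) : G.Node := G.src p.1.2.2 p.2

/-- The node at a target position. -/
def tgtPort {G : Hyp S} (p : G.TgtPort) : G.Node := G.tgt p.1.2.2 p.2

theorem acyclic_of_wellFounded {G : Hyp S}
    (h : WellFounded (IsPredecessor : G.Hyperedge → G.Hyperedge → Prop)) : G.Acyclic := by
  rintro v p ⟨a, b, ⟨ha, hb, hp⟩, hs, ht⟩
  obtain ⟨l, rfl⟩ : ∃ l, p = a :: l := by
    cases p with
    | nil => simp at ha
    | cons x l => exact ⟨l, by simpa using ha⟩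
  have hr : Relation.ReflTransGen IsPredecessor a b :=
    List.relationReflTransGen_of_exists_isChain_cons l hp (by
      rw [List.getLast?_eq_some_getLast (by simp)] at hb
      exact Option.some.inj hb)
  have : Relation.TransGen IsPredecessor a a := Relation.TransGen.tail' hr ⟨v, ht, hs⟩
  exact h.transGen.irrefl.irrefl a this

theorem wellFounded_of_acyclic {G : Hyp S} [Finite G.Hyperedge] (h : G.Acyclic) :
    WellFounded (IsPredecessor : G.Hyperedge → G.Hyperedge → Prop) := by
  have : Std.Irrefl (Relation.TransGen (IsPredecessor : G.Hyperedge → G.Hyperedge → Prop)) := by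
    refine ⟨fun a ha => ?_⟩
    obtain ⟨b, hab, v, ht, hs⟩ := Relation.TransGen.tail'_iff.1 ha
    obtain ⟨l, hl, hb⟩ := List.exists_isChain_cons_of_relationReflTransGen hab
    refine h v (a :: l) ⟨a, b, ⟨rfl, ?_, hl⟩, hs, ht⟩
    rw [List.getLast?_eq_some_getLast (by simp), hb]
  exact Subrelation.wf Relation.TransGen.single
    (Finite.wellFounded_of_trans_of_irrefl (Relation.TransGen IsPredecessor))

/-- The action of a homomorphism on hyperedges. -/
def Hom.hyperedge {G H : Hyp S} (f : G ⟶ H) (h : G.Hyperedge) : H.Hyperedge :=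
  ⟨h.1, h.2.1, f.edge h.2.2⟩

theorem IsPredecessor.map {G H : Hyp S} (f : G ⟶ H) {a b : G.Hyperedge}
    (h : IsPredecessor a b) : IsPredecessor (Hom.hyperedge f a) (Hom.hyperedge f b) := by
  obtain ⟨_, ⟨i, rfl⟩, ⟨j, hj⟩⟩ := h
  exact ⟨f.node _, ⟨i, f.tgt_edge _ _⟩, ⟨j, (f.src_edge _ _).trans (congrArg f.node hj)⟩⟩

theorem wellFounded_of_hom {G H : Hyp S} (f : G ⟶ H)
    (h : WellFounded (IsPredecessor : H.Hyperedge → H.Hyperedge → Prop)) :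
    WellFounded (IsPredecessor : G.Hyperedge → G.Hyperedge → Prop) :=
  Subrelation.wf (fun hab => hab.map f) (InvImage.wf (Hom.hyperedge f) h)

/-- A homomorphism that is bijective on nodes and hyperedges is an isomorphism. -/
theorem exists_iso_of_bijective {G H : Hyp S} (f : G ⟶ H) (hn : Function.Bijective f.node)
    (he : ∀ k l, Function.Bijective (f.edge : G.Edge k l → H.Edge k l)) :
    ∃ α : G ≅ H, α.hom = f := by
  let en := Equiv.ofBijective _ hn
  let ee := fun k l => Equiv.ofBijective _ (he k l)
  have hen : ∀ v, f.node (en.symm v) = v := en.apply_symm_apply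
  have hee : ∀ k l e, f.edge ((ee k l).symm e) = e := fun k l => (ee k l).apply_symm_apply
  refine ⟨⟨f, ⟨en.symm, fun {k l} => (ee k l).symm, ?_, ?_, ?_⟩, ?_, ?_⟩, rfl⟩
  · intro k l e i
    apply hn.1
    rw [hen, ← f.src_edge, hee]
  · intro k l e i
    apply hn.1
    rw [hen, ← f.tgt_edge, hee]
  · intro k l e
    rw [← f.label_edge, hee]
  · exact hom_ext (fun v => en.symm_apply_apply v) fun k l e => (ee k l).symm_apply_apply e
  · exact hom_ext hen hee

end Hyp

namespace Cospan

open Hyp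

variable {S : Signature.{u}}

/-- Every node is either an input or a target of a hyperedge, in a unique way; every node is
either an output or a source of a hyperedge, in a unique way; and the hyperedges are well-founded.
-/
structure WellFormed {n m : ℕ} (c : Cospan S n m) : Prop where
  tgt_bijective : Function.Bijective (Sum.elim c.left.node (tgtPort (G := c.carrier)))
  src_bijective : Function.Bijective (Sum.elim c.right.node (srcPort (G := c.carrier)))
  wellFounded : WellFounded
    (IsPredecessor : c.carrier.Hyperedge → c.carrier.Hyperedge → Prop)

theorem monogamous_iff {n m : ℕ} (c : Cospan S n m) : c.Monogamous ↔
    Function.Bijective (Sum.elim c.left.node (tgtPort (G := c.carrier))) ∧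
      Function.Bijective (Sum.elim c.right.node (srcPort (G := c.carrier))) := by
  rw [bijective_sumElim_iff, bijective_sumElim_iff]
  constructor
  · rintro ⟨h1, h2, h3, h4, h5, h6⟩
    exact ⟨⟨(mono_iff_injective_node _).1 h1, h3, h4⟩, (mono_iff_injective_node _).1 h2, h5, h6⟩
  · rintro ⟨⟨h1, h3, h4⟩, h2, h5, h6⟩
    exact ⟨(mono_iff_injective_node _).2 h1, (mono_iff_injective_node _).2 h2, h3, h4, h5, h6⟩

theorem finite_hyperedge {n m : ℕ} {c : Cospan S n m} (h : c.Monogamous) :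
    Finite c.carrier.Hyperedge := by
  obtain ⟨h1, h2⟩ := (monogamous_iff c).1 h
  have := c.carrier.finite_node
  have := c.carrier.finite_edge 0 0
  have : Finite c.carrier.TgtPort :=
    Finite.of_injective _ (Sum.elim_injective.1 h1.1).2.1
  have : Finite c.carrier.SrcPort :=
    Finite.of_injective _ (Sum.elim_injective.1 h2.1).2.1
  let f : c.carrier.TgtPort ⊕ c.carrier.SrcPort ⊕ c.carrier.Edge 0 0 → c.carrier.Hyperedge :=
    Sum.elim Sigma.fst (Sum.elim Sigma.fst fun e => ⟨0, 0, e⟩)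
  refine Finite.of_surjective f ?_
  rintro ⟨_ | k, _ | l, e⟩
  · exact ⟨.inr (.inr e), rfl⟩
  · exact ⟨.inl ⟨⟨0, l + 1, e⟩, (0 : Fin (l + 1))⟩, rfl⟩
  · exact ⟨.inr (.inl ⟨⟨k + 1, 0, e⟩, (0 : Fin (k + 1))⟩), rfl⟩
  · exact ⟨.inl ⟨⟨k + 1, l + 1, e⟩, (0 : Fin (l + 1))⟩, rfl⟩

theorem wellFormed_iff {n m : ℕ} (c : Cospan S n m) :
    c.WellFormed ↔ c.Monogamous ∧ c.Acyclic := by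
  constructor
  · rintro ⟨h1, h2, h3⟩
    exact ⟨(monogamous_iff c).2 ⟨h1, h2⟩, acyclic_of_wellFounded h3⟩
  · rintro ⟨h, ha⟩
    have := finite_hyperedge h
    obtain ⟨h1, h2⟩ := (monogamous_iff c).1 h
    exact ⟨h1, h2, wellFounded_of_acyclic ha⟩

/-- Target positions of a disjoint union of families of hyperedges. -/
def tgtSumEquiv (E F : ℕ → ℕ → Type) :
    (Σ h : (Σ k l, E k l ⊕ F k l), Fin h.2.1) ≃
      (Σ h : (Σ k l, E k l), Fin h.2.1) ⊕ Σ h : (Σ k l, F k l), Fin h.2.1 where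
  toFun := fun ⟨⟨k, l, e⟩, i⟩ =>
    e.elim (fun e => .inl ⟨⟨k, l, e⟩, i⟩) fun e => .inr ⟨⟨k, l, e⟩, i⟩
  invFun := Sum.elim (fun p => ⟨⟨p.1.1, p.1.2.1, .inl p.1.2.2⟩, p.2⟩)
    fun p => ⟨⟨p.1.1, p.1.2.1, .inr p.1.2.2⟩, p.2⟩
  left_inv := by rintro ⟨⟨k, l, e | e⟩, i⟩ <;> rfl
  right_inv := by rintro (⟨⟨k, l, e⟩, i⟩ | ⟨⟨k, l, e⟩, i⟩) <;> rfl

/-- Source positions of a disjoint union of families of hyperedges. -/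
def srcSumEquiv (E F : ℕ → ℕ → Type) :
    (Σ h : (Σ k l, E k l ⊕ F k l), Fin h.1) ≃
      (Σ h : (Σ k l, E k l), Fin h.1) ⊕ Σ h : (Σ k l, F k l), Fin h.1 where
  toFun := fun ⟨⟨k, l, e⟩, i⟩ =>
    e.elim (fun e => .inl ⟨⟨k, l, e⟩, i⟩) fun e => .inr ⟨⟨k, l, e⟩, i⟩
  invFun := Sum.elim (fun p => ⟨⟨p.1.1, p.1.2.1, .inl p.1.2.2⟩, p.2⟩)
    fun p => ⟨⟨p.1.1, p.1.2.1, .inr p.1.2.2⟩, p.2⟩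
  left_inv := by rintro ⟨⟨k, l, e | e⟩, i⟩ <;> rfl
  right_inv := by rintro (⟨⟨k, l, e⟩, i⟩ | ⟨⟨k, l, e⟩, i⟩) <;> rfl

theorem wellFounded_sum {G H K : Hyp S} (φ : K.Hyperedge → G.Hyperedge ⊕ H.Hyperedge)
    (hG : WellFounded (IsPredecessor : G.Hyperedge → G.Hyperedge → Prop))
    (hH : WellFounded (IsPredecessor : H.Hyperedge → H.Hyperedge → Prop))
    (h : ∀ a b : K.Hyperedge, IsPredecessor a b →
      Sum.Lex IsPredecessor IsPredecessor (φ a) (φ b)) :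
    WellFounded (IsPredecessor : K.Hyperedge → K.Hyperedge → Prop) :=
  Subrelation.wf (fun hab => h _ _ hab) (InvImage.wf φ (Sum.lex_wf hG hH))

/-- The hyperedges of a disjoint union of families of hyperedges. -/
def hyperedgeSum (E F : ℕ → ℕ → Type) (h : Σ k l, E k l ⊕ F k l) :
    (Σ k l, E k l) ⊕ (Σ k l, F k l) :=
  h.2.2.elim (fun e => .inl ⟨_, _, e⟩) fun e => .inr ⟨_, _, e⟩

theorem _root_.Equiv.bijective_of_comp_eq {α β γ : Type*} (e : α ≃ β) {f : β → γ} {g : α → γ}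
    (h : ∀ x, f (e x) = g x) (hg : Function.Bijective g) : Function.Bijective f :=
  (Function.Bijective.of_comp_iff f e.bijective).1 ((funext h : f ∘ e = g) ▸ hg)

theorem WellFormed.comp {n m k : ℕ} {c : Cospan S n m} {d : Cospan S m k} (hc : c.WellFormed)
    (hd : d.WellFormed) : (c.comp d).WellFormed := by
  have hr := bijective_glue_right c.right.node d.left.node hd.tgt_bijective
  have hl := bijective_glue_left c.right.node d.left.node hc.src_bijective
  refine ⟨?_, ?_, ?_⟩
  · refine Equiv.bijective_of_comp_eq (((Equiv.refl _).sumCongr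
      (tgtSumEquiv c.carrier.Edge d.carrier.Edge)).trans (Equiv.sumAssoc _ _ _).symm).symm ?_
      (hr.comp (hc.tgt_bijective.sumMap Function.bijective_id))
    rintro ((i | ⟨⟨k, l, e⟩, i⟩) | ⟨⟨k, l, e⟩, i⟩) <;> rfl
  · refine Equiv.bijective_of_comp_eq (((Equiv.refl _).sumCongr
      ((srcSumEquiv c.carrier.Edge d.carrier.Edge).trans (Equiv.sumComm _ _))).trans
      (Equiv.sumAssoc _ _ _).symm).symm ?_
      (hl.comp (hd.src_bijective.sumMap Function.bijective_id))
    rintro ((i | ⟨⟨k, l, e⟩, i⟩) | ⟨⟨k, l, e⟩, i⟩) <;> rfl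
  · refine wellFounded_sum (hyperedgeSum c.carrier.Edge d.carrier.Edge) hc.wellFounded
      hd.wellFounded ?_
    rintro ⟨k, l, a | a⟩ ⟨k', l', b | b⟩ ⟨_, ⟨i, rfl⟩, ⟨j, hj⟩⟩
    · exact Sum.Lex.inl ⟨_, ⟨i, rfl⟩, ⟨j, (Sum.elim_injective.1 hr.1).1 hj⟩⟩
    · exact Sum.Lex.sep _ _
    · exact ((Sum.elim_injective.1 hr.1).2.2 _ ⟨⟨k, l, a⟩, i⟩ hj).elim
    · exact Sum.Lex.inr ⟨_, ⟨i, rfl⟩, ⟨j, (Sum.elim_injective.1 hl.1).1 hj⟩⟩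

theorem WellFormed.tensor {n m n' m' : ℕ} {c : Cospan S n m} {d : Cospan S n' m'}
    (hc : c.WellFormed) (hd : d.WellFormed) : (c.tensor d).WellFormed := by
  refine ⟨?_, ?_, ?_⟩
  · refine Equiv.bijective_of_comp_eq ((Equiv.sumSumSumComm _ _ _ _).trans (finSumFinEquiv.sumCongr
      (tgtSumEquiv c.carrier.Edge d.carrier.Edge).symm)) ?_
      (hc.tgt_bijective.sumMap hd.tgt_bijective)
    rintro ((i | ⟨⟨k, l, e⟩, i⟩) | (i | ⟨⟨k, l, e⟩, i⟩))
    · exact congrArg (fun p => Hom.node p i) (discreteInl_desc (c.left ≫ sumInl _ d.carrier) _)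
    · rfl
    · exact congrArg (fun p => Hom.node p i) (discreteInr_desc _ (d.left ≫ sumInr c.carrier _))
    · rfl
  · refine Equiv.bijective_of_comp_eq ((Equiv.sumSumSumComm _ _ _ _).trans (finSumFinEquiv.sumCongr
      (srcSumEquiv c.carrier.Edge d.carrier.Edge).symm)) ?_
      (hc.src_bijective.sumMap hd.src_bijective)
    rintro ((i | ⟨⟨k, l, e⟩, i⟩) | (i | ⟨⟨k, l, e⟩, i⟩))
    · exact congrArg (fun p => Hom.node p i) (discreteInl_desc (c.right ≫ sumInl _ d.carrier) _)
    · rfl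
    · exact congrArg (fun p => Hom.node p i) (discreteInr_desc _ (d.right ≫ sumInr c.carrier _))
    · rfl
  · refine wellFounded_sum (hyperedgeSum c.carrier.Edge d.carrier.Edge) hc.wellFounded
      hd.wellFounded ?_
    rintro ⟨k, l, a | a⟩ ⟨k', l', b | b⟩ ⟨_, ⟨i, rfl⟩, ⟨j, hj⟩⟩
    · exact Sum.Lex.inl ⟨_, ⟨i, rfl⟩, ⟨j, Sum.inl_injective hj⟩⟩
    · exact Sum.Lex.sep _ _
    · cases hj
    · exact Sum.Lex.inr ⟨_, ⟨i, rfl⟩, ⟨j, Sum.inr_injective hj⟩⟩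

instance (n : ℕ) : IsEmpty (discrete S n).Hyperedge := ⟨fun h => h.2.2.elim⟩

theorem wellFormed_ofHom {a b : ℕ} {r : discrete S b ⟶ discrete S a}
    (hr : Function.Bijective r.node) : (ofHom r).WellFormed := by
  refine ⟨?_, ?_, ⟨fun h => h.2.2.elim⟩⟩
  · exact (Equiv.sumEmpty (Fin a) (discrete S a).TgtPort).symm.bijective_of_comp_eq
      (fun _ => rfl) Function.bijective_id
  · exact (Equiv.sumEmpty (Fin b) (discrete S a).SrcPort).symm.bijective_of_comp_eq
      (fun _ => rfl) hr

theorem bijective_discreteSwap (n m : ℕ) : Function.Bijective (discreteSwap S n m).node := by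
  have h : ∀ n m, Function.LeftInverse (discreteSwap S n m).node (discreteSwap S m n).node :=
    fun n m i => congrArg (fun p => Hom.node p i) (discreteSwap_swap (S := S) m n)
  exact ⟨(h m n).injective, (h n m).surjective⟩

theorem wellFormed_ofOp {k l : ℕ} (o : S.Op k l) : (ofOp o).WellFormed := by
  refine ⟨?_, ?_, ?_⟩
  · refine Equiv.bijective_of_comp_eq (α := Fin k ⊕ Fin l) ((Equiv.refl _).sumCongr
      ⟨fun i => ⟨⟨k, l, .edge⟩, i⟩, fun p => match p with | ⟨⟨_, _, .edge⟩, i⟩ => i,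
        fun _ => rfl, by rintro ⟨⟨_, _, ⟨⟩⟩, i⟩; rfl⟩) ?_ Function.bijective_id
    rintro (i | i) <;> rfl
  · refine Equiv.bijective_of_comp_eq (α := Fin l ⊕ Fin k) ((Equiv.refl _).sumCongr
      ⟨fun i => ⟨⟨k, l, .edge⟩, i⟩, fun p => match p with | ⟨⟨_, _, .edge⟩, i⟩ => i,
        fun _ => rfl, by rintro ⟨⟨_, _, ⟨⟩⟩, i⟩; rfl⟩) ?_ (Equiv.sumComm _ _).bijective
    rintro (i | i) <;> rfl
  · refine ⟨fun a => ⟨a, ?_⟩⟩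
    rintro ⟨_, _, ⟨⟩⟩ ⟨_, ⟨i, rfl⟩, ⟨j, hj⟩⟩
    rcases a with ⟨_, _, ⟨⟩⟩
    cases hj

theorem exists_wellFormed_eval {n m : ℕ} (t : Term S n m) : ∃ c : Cospan S n m,
    t.eval (Csp S) (fun o => Quotient.mk _ (ofOp o)) = Quotient.mk _ c ∧ c.WellFormed := by
  induction t with
  | op o => exact ⟨_, rfl, wellFormed_ofOp o⟩
  | id n => exact ⟨_, rfl, wellFormed_ofHom Function.bijective_id⟩
  | symm m n => exact ⟨_, rfl, wellFormed_ofHom (bijective_discreteSwap n m)⟩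
  | comp s t hs ht =>
    obtain ⟨c, hc, hc'⟩ := hs
    obtain ⟨d, hd, hd'⟩ := ht
    exact ⟨c.comp d, congrArg₂ (Csp S).comp hc hd, hc'.comp hd'⟩
  | tensor s t hs ht =>
    obtain ⟨c, hc, hc'⟩ := hs
    obtain ⟨d, hd, hd'⟩ := ht
    exact ⟨c.tensor d, congrArg₂ (Csp S).tensor hc hd, hc'.tensor hd'⟩

theorem WellFormed.of_isomorphic {n m : ℕ} {c d : Cospan S n m} (h : Isomorphic c d)
    (hc : c.WellFormed) : d.WellFormed := by
  obtain ⟨⟨f, g, hfg, hgf⟩, hl, hr⟩ := h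
  have hn : Function.Bijective f.node :=
    ⟨Function.LeftInverse.injective (g := g.node) fun v => congrArg (fun p => Hom.node p v) hfg,
      Function.RightInverse.surjective (g := g.node) fun v => congrArg (fun p => Hom.node p v) hgf⟩
  have e1 : ∀ {k l : ℕ} (e : c.carrier.Edge k l), g.edge (f.edge e) = e :=
    fun e => congrArg (fun p => Hom.edge p e) hfg
  have e2 : ∀ {k l : ℕ} (e : d.carrier.Edge k l), f.edge (g.edge e) = e :=
    fun e => congrArg (fun p => Hom.edge p e) hgf
  refine ⟨?_, ?_, wellFounded_of_hom g hc.wellFounded⟩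
  · refine Equiv.bijective_of_comp_eq ((Equiv.refl _).sumCongr
      ⟨fun p => ⟨Hom.hyperedge f p.1, p.2⟩, fun p => ⟨Hom.hyperedge g p.1, p.2⟩, ?_, ?_⟩) ?_
      (hn.comp hc.tgt_bijective)
    · rintro ⟨⟨k, l, e⟩, i⟩
      exact congrArg (fun e' => (⟨⟨k, l, e'⟩, i⟩ : c.carrier.TgtPort)) (e1 e)
    · rintro ⟨⟨k, l, e⟩, i⟩
      exact congrArg (fun e' => (⟨⟨k, l, e'⟩, i⟩ : d.carrier.TgtPort)) (e2 e)
    · rintro (i | ⟨⟨k, l, e⟩, i⟩)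
      · exact (congrArg (fun p => Hom.node p i) hl).symm
      · exact f.tgt_edge e i
  · refine Equiv.bijective_of_comp_eq ((Equiv.refl _).sumCongr
      ⟨fun p => ⟨Hom.hyperedge f p.1, p.2⟩, fun p => ⟨Hom.hyperedge g p.1, p.2⟩, ?_, ?_⟩) ?_
      (hn.comp hc.src_bijective)
    · rintro ⟨⟨k, l, e⟩, i⟩
      exact congrArg (fun e' => (⟨⟨k, l, e'⟩, i⟩ : c.carrier.SrcPort)) (e1 e)
    · rintro ⟨⟨k, l, e⟩, i⟩
      exact congrArg (fun e' => (⟨⟨k, l, e'⟩, i⟩ : d.carrier.SrcPort)) (e2 e)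
    · rintro (i | ⟨⟨k, l, e⟩, i⟩)
      · exact (congrArg (fun p => Hom.node p i) hr).symm
      · exact f.src_edge e i

end Cospan

theorem bijective_of_bijective_sumElim_comp {U V B Q : Type*} {b : B → Q} {g : U → B} {v : V → Q}
    (h1 : Function.Bijective (Sum.elim (fun x => b (g x)) v))
    (h2 : Function.Bijective (Sum.elim b v)) : Function.Bijective g := by
  refine ⟨Function.Injective.of_comp (f := b) (Sum.elim_injective.1 h1.1).1, fun y => ?_⟩
  obtain ⟨x | p, hx⟩ := h1.2 (b y)
  · exact ⟨x, (Sum.elim_injective.1 h2.1).1 hx⟩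
  · exact ((Sum.elim_injective.1 h2.1).2.2 y p hx.symm).elim

theorem exists_perm_castAdd {k q : ℕ} {s : Fin k → Fin (k + q)} (hs : Function.Injective s) :
    ∃ σ : Equiv.Perm (Fin (k + q)), ∀ i, σ (Fin.castAdd q i) = s i := by
  let e : {x // x ∈ Set.range (Fin.castAdd q : Fin k → _)} ≃ {x // x ∈ Set.range s} :=
    (Equiv.ofInjective _ (Fin.castAdd_injective k q)).symm.trans (Equiv.ofInjective s hs)
  classical
  refine ⟨e.extendSubtype, fun i => ?_⟩
  rw [e.extendSubtype_apply_of_mem _ ⟨i, rfl⟩]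
  have : (Equiv.ofInjective _ (Fin.castAdd_injective k q)).symm ⟨Fin.castAdd q i, i, rfl⟩ = i :=
    (Equiv.ofInjective _ (Fin.castAdd_injective k q)).symm_apply_apply i
  simp [e, this]

namespace Cospan

open Hyp

variable {S : Signature.{u}}

theorem WellFormed.of_comp {n m k : ℕ} {c : Cospan S n m} {d : Cospan S m k} (hc : c.WellFormed)
    (h : (c.comp d).WellFormed) : d.WellFormed := by
  have hl := bijective_glue_left c.right.node d.left.node hc.src_bijective
  refine ⟨?_, ?_, wellFounded_of_hom (glueInr c.right d.left) h.wellFounded⟩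
  · refine bijective_of_bijective_sumElim_comp ?_ hl
    let e₁ := Equiv.ofBijective _ hc.tgt_bijective
    let e₂ := Equiv.ofBijective _ hc.src_bijective
    refine Equiv.bijective_of_comp_eq ?_ ?_ h.tgt_bijective
    · exact ((Equiv.refl _).sumCongr (tgtSumEquiv c.carrier.Edge d.carrier.Edge)).trans
        ((Equiv.sumAssoc _ _ _).symm.trans (((e₁.trans e₂.symm).sumCongr (Equiv.refl _)).trans
          ((Equiv.sumAssoc _ _ _).trans (((Equiv.refl _).sumCongr (Equiv.sumComm _ _)).trans
            (Equiv.sumAssoc _ _ _).symm))))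
    · have key : ∀ v, Sum.elim
          (fun i => Quot.mk (GlueRel c.right.node d.left.node) (.inr (d.left.node i)))
          (fun p => Quot.mk (GlueRel c.right.node d.left.node) (.inl (srcPort p))) (e₂.symm v) =
          Quot.mk _ (.inl v) := fun v => by
        obtain ⟨i | p, rfl⟩ := e₂.surjective v
        · rw [e₂.symm_apply_apply]
          exact (Quot.sound ⟨i, rfl, rfl⟩).symm
        · rw [e₂.symm_apply_apply]
          rfl
      have key' : ∀ v : c.carrier.Node, Sum.elim
          (fun x => Quot.mk (GlueRel c.right.node d.left.node)
            (.inr (Sum.elim d.left.node tgtPort x)))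
          (fun p => Quot.mk (GlueRel c.right.node d.left.node) (.inl (srcPort p)))
          ((Equiv.sumAssoc _ _ _).symm (Sum.map _root_.id Sum.swap
            (Equiv.sumAssoc _ _ _ (Sum.inl (β := d.carrier.TgtPort) (e₂.symm v))))) =
          Quot.mk _ (.inl v) := fun v => by
        rw [← key v]
        rcases e₂.symm v with i | p <;> rfl
      rintro (i | ⟨⟨k, l, e | e⟩, i⟩)
      · exact key' _
      · exact key' _
      · rfl
  · refine bijective_of_bijective_sumElim_comp ?_ hl
    refine Equiv.bijective_of_comp_eq (((Equiv.refl _).sumCongr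
      ((srcSumEquiv c.carrier.Edge d.carrier.Edge).trans (Equiv.sumComm _ _))).trans
      (Equiv.sumAssoc _ _ _).symm) ?_ h.src_bijective
    rintro (i | ⟨⟨k, l, e | e⟩, i⟩) <;> rfl

theorem discreteDesc_node_castAdd {m n : ℕ} {G : Hyp S} (f : discrete S m ⟶ G)
    (g : discrete S n ⟶ G) (i : Fin m) : (discreteDesc f g).node (Fin.castAdd n i) = f.node i :=
  Fin.addCases_left (motive := fun _ => G.Node) i

theorem discreteDesc_node_natAdd {m n : ℕ} {G : Hyp S} (f : discrete S m ⟶ G)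
    (g : discrete S n ⟶ G) (i : Fin n) : (discreteDesc f g).node (Fin.natAdd m i) = g.node i :=
  Fin.addCases_right (motive := fun _ => G.Node) i

/-- The cospan is the interpretation of a string diagram. -/
def Expressible {n m : ℕ} (c : Cospan S n m) : Prop :=
  ∃ t : (Syn S).Hom n m,
    (interpretation S).map t = (Quotient.mk (setoid S n m) c : (Csp S).Hom n m)

theorem Expressible.of_isomorphic {n m : ℕ} {c d : Cospan S n m} (h : Isomorphic c d)
    (hc : c.Expressible) : d.Expressible :=
  hc.imp fun _ ht => ht.trans (Quotient.sound h)

theorem Expressible.comp {n m k : ℕ} {c : Cospan S n m} {d : Cospan S m k} (hc : c.Expressible)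
    (hd : d.Expressible) : (c.comp d).Expressible := by
  obtain ⟨s, hs⟩ := hc
  obtain ⟨t, ht⟩ := hd
  exact ⟨(Syn S).comp s t, ((interpretation S).map_comp s t).trans (congrArg₂ (Csp S).comp hs ht)⟩

theorem Expressible.tensor {n m n' m' : ℕ} {c : Cospan S n m} {d : Cospan S n' m'}
    (hc : c.Expressible) (hd : d.Expressible) : (c.tensor d).Expressible := by
  obtain ⟨s, hs⟩ := hc
  obtain ⟨t, ht⟩ := hd
  exact ⟨(Syn S).tensor s t,
    ((interpretation S).map_tensor s t).trans (congrArg₂ (Csp S).tensor hs ht)⟩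

theorem expressible_id (n : ℕ) : (Cospan.id S n).Expressible :=
  ⟨(Syn S).id n, (interpretation S).map_id n⟩

theorem expressible_symm (m n : ℕ) : (Cospan.symm S m n).Expressible :=
  ⟨(Syn S).symm m n, (interpretation S).map_symm m n⟩

theorem expressible_ofOp {k l : ℕ} (o : S.Op k l) : (ofOp o).Expressible :=
  ⟨Quotient.mk _ (Term.op o), rfl⟩

theorem expressible_adjacent_swap (i k : ℕ) {N : ℕ} (h : i + (1 + 1) + k = N)
    (f : Fin N → Fin N)
    (hf : ∀ x, (f x : ℕ) = if (x : ℕ) = i then i + 1 else if (x : ℕ) = i + 1 then i else x) :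
    (ofHom (S := S) (ofFun f : discrete S N ⟶ discrete S N)).Expressible := by
  subst h
  have h1 := tensor_ofHom (𝟙 (discrete S i)) (discreteSwap S 1 1)
  have h2 := isomorphic_trans (tensor_congr h1 ((setoid S k k).iseqv.refl (Cospan.id S k)))
    (tensor_ofHom _ _)
  have h3 := Expressible.of_isomorphic h2
    (((expressible_id i).tensor (expressible_symm 1 1)).tensor (expressible_id k))
  convert h3 using 2
  refine discrete_hom_ext fun x => Fin.ext ((hf x).trans ?_)
  refine Fin.addCases (fun x => ?_) (fun x => ?_) x
  · refine Fin.addCases (fun x => ?_) (fun x => ?_) x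
    · refine .trans ?_ (congrArg Fin.val (discreteDesc_node_castAdd _ _ _)).symm
      refine .trans ?_ (congrArg (fun v : Fin (i + (1 + 1)) => v.val)
          (discreteDesc_node_castAdd (𝟙 (discrete S i) ≫ discreteInl S i (1 + 1))
            (discreteSwap S 1 1 ≫ discreteInr S i (1 + 1)) x)).symm
      have := x.2
      change (if (x : ℕ) = i then i + 1 else if (x : ℕ) = i + 1 then i else x) = (x : ℕ)
      split_ifs <;> omega
    · refine .trans ?_ (congrArg Fin.val (discreteDesc_node_castAdd _ _ _)).symm
      refine .trans ?_ (congrArg (fun v : Fin (i + (1 + 1)) => v.val)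
          (discreteDesc_node_natAdd (𝟙 (discrete S i) ≫ discreteInl S i (1 + 1))
            (discreteSwap S 1 1 ≫ discreteInr S i (1 + 1)) x)).symm
      refine Fin.addCases (fun x => ?_) (fun x => ?_) x
      · refine .trans ?_ (congrArg (fun v : Fin 2 => i + v.val)
          (discreteDesc_node_castAdd _ _ _)).symm
        obtain rfl := Subsingleton.elim x 0
        change (if i + 0 = i then i + 1 else if i + 0 = i + 1 then i else i + 0) = i + (1 + 0)
        simp
      · refine .trans ?_ (congrArg (fun v : Fin 2 => i + v.val)
          (discreteDesc_node_natAdd _ _ _)).symm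
        obtain rfl := Subsingleton.elim x 0
        change (if i + (1 + 0) = i then i + 1 else if i + (1 + 0) = i + 1 then i else i + (1 + 0)) =
          i + 0
        simp
  · refine .trans ?_ (congrArg Fin.val (discreteDesc_node_natAdd _ _ _)).symm
    change (if i + (1 + 1) + (x : ℕ) = i then i + 1 else
      if i + (1 + 1) + (x : ℕ) = i + 1 then i else i + (1 + 1) + (x : ℕ)) = i + (1 + 1) + (x : ℕ)
    split_ifs <;> omega

theorem expressible_perm {n : ℕ} (σ : Equiv.Perm (Fin n)) :
    (ofHom (S := S) (ofFun σ : discrete S n ⟶ discrete S n)).Expressible := by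
  have h1 : ∀ n, (ofFun (1 : Equiv.Perm (Fin n)) : discrete S n ⟶ discrete S n) = 𝟙 _ :=
    fun _ => discrete_hom_ext fun _ => rfl
  have h2 : ∀ {n} (a b : Equiv.Perm (Fin n)),
      (ofFun (a * b) : discrete S n ⟶ discrete S n) = ofFun b ≫ ofFun a :=
    fun _ _ => discrete_hom_ext fun _ => rfl
  cases n with
  | zero =>
    rw [Subsingleton.elim σ 1]
    rw [h1]
    exact expressible_id 0
  | succ n =>
    let M : Submonoid (Equiv.Perm (Fin (n + 1))) :=
      { carrier := {σ | (ofHom (S := S)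
          (ofFun σ : discrete S (n + 1) ⟶ discrete S (n + 1))).Expressible}
        one_mem' := by
          rw [Set.mem_ofPred_eq, h1]
          exact expressible_id (n + 1)
        mul_mem' := fun {a b} ha hb => by
          rw [Set.mem_ofPred_eq, h2]
          exact .of_isomorphic (comp_ofHom _ _) (Expressible.comp ha hb) }
    have hM : M = ⊤ := by
      rw [eq_top_iff, ← Equiv.Perm.mclosure_swap_castSucc_succ, Submonoid.closure_le]
      rintro _ ⟨i, rfl⟩
      refine expressible_adjacent_swap i (n - 1 - i) (by omega) _ fun x => ?_
      simp only [Equiv.swap_apply_def, Fin.ext_iff]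
      split_ifs <;> simp_all
    exact (hM ▸ Submonoid.mem_top σ : σ ∈ M)

theorem WellFormed.expressible_of_isEmpty {n m : ℕ} {c : Cospan S n m} (h : c.WellFormed)
    [he : IsEmpty c.carrier.Hyperedge] : c.Expressible := by
  have hl : Function.Bijective c.left.node :=
    h.tgt_bijective.comp (Equiv.sumEmpty (Fin n) c.carrier.TgtPort).symm.bijective
  have hr : Function.Bijective c.right.node :=
    h.src_bijective.comp (Equiv.sumEmpty (Fin m) c.carrier.SrcPort).symm.bijective
  let L : Fin n ≃ c.carrier.Node := Equiv.ofBijective _ hl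
  let R : Fin m ≃ c.carrier.Node := Equiv.ofBijective _ hr
  obtain rfl : n = m := by simpa using Fintype.card_congr (L.trans R.symm)
  obtain ⟨α, hα⟩ := exists_iso_of_bijective c.left hl fun k l =>
    ⟨fun e => e.elim, fun e => he.elim ⟨k, l, e⟩⟩
  refine Expressible.of_isomorphic ⟨α, ?_, ?_⟩ (expressible_perm (R.trans L.symm))
  · rw [hα]
    exact Category.id_comp _
  · rw [hα]
    exact discrete_hom_ext fun i => L.apply_symm_apply (R i)

end Cospan

/-- The hypergraph obtained by erasing a hyperedge together with its sources. -/
def Hyp.erase {S : Signature.{u}} (G : Hyp S) {k l : ℕ} (e : G.Edge k l)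
    (hs : ∀ p : G.SrcPort, p.1 ≠ ⟨k, l, e⟩ → srcPort p ∉ Set.range (G.src e))
    (ht : ∀ p : G.TgtPort, tgtPort p ∉ Set.range (G.src e)) : Hyp S where
  Node := {v // v ∉ Set.range (G.src e)}
  Edge k' l' := {e' : G.Edge k' l' // (⟨k', l', e'⟩ : G.Hyperedge) ≠ ⟨k, l, e⟩}
  finite_node := by have := G.finite_node; infer_instance
  finite_edge k' l' := by have := G.finite_edge k' l'; infer_instance
  src e' i := ⟨G.src e'.1 i, hs ⟨⟨_, _, e'.1⟩, i⟩ e'.2⟩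
  tgt e' i := ⟨G.tgt e'.1 i, ht ⟨⟨_, _, e'.1⟩, i⟩⟩
  label e' := G.label e'.1

/-- The inclusion of the hypergraph obtained by erasing a hyperedge. -/
def Hyp.eraseHom {S : Signature.{u}} (G : Hyp S) {k l : ℕ} (e : G.Edge k l)
    (hs : ∀ p : G.SrcPort, p.1 ≠ ⟨k, l, e⟩ → srcPort p ∉ Set.range (G.src e))
    (ht : ∀ p : G.TgtPort, tgtPort p ∉ Set.range (G.src e)) : G.erase e hs ht ⟶ G where
  node := Subtype.val
  edge := Subtype.val
  src_edge _ _ := rfl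
  tgt_edge _ _ := rfl
  label_edge _ := rfl

/-- The homomorphism that picks out a hyperedge. -/
def Hyp.ofEdge {S : Signature.{u}} (G : Hyp S) {k l : ℕ} (e : G.Edge k l) :
    (Cospan.ofOp (G.label e)).carrier ⟶ G where
  node := Sum.elim (G.src e) (G.tgt e)
  edge e' := match e' with | .edge => e
  src_edge e' i := match e', i with | .edge, _ => rfl
  tgt_edge e' i := match e', i with | .edge, _ => rfl
  label_edge e' := match e' with | .edge => rfl

namespace Cospan

open Hyp

variable {S : Signature.{u}}

theorem WellFormed.exists_decomposition {k l q m : ℕ} {c : Cospan S (k + q) m}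
    (h : c.WellFormed) (e : c.carrier.Edge k l)
    (he : ∀ i, c.carrier.src e i = c.left.node (Fin.castAdd q i)) :
    ∃ d : Cospan S (l + q) m,
      Isomorphic (((ofOp (c.carrier.label e)).tensor (Cospan.id S q)).comp d) c ∧
        (Finite c.carrier.Hyperedge →
          Nat.card d.carrier.Hyperedge < Nat.card c.carrier.Hyperedge) := by
  obtain ⟨hl, ht, hlt⟩ := Sum.elim_injective.1 h.tgt_bijective.1
  obtain ⟨hr, hs, hrs⟩ := Sum.elim_injective.1 h.src_bijective.1
  have hs' : ∀ p : c.carrier.SrcPort, p.1 ≠ ⟨k, l, e⟩ →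
      srcPort p ∉ Set.range (c.carrier.src e) := by
    rintro p hp ⟨i, hi⟩
    exact hp (congrArg Sigma.fst (@hs ⟨⟨k, l, e⟩, i⟩ p hi)).symm
  have ht' : ∀ p : c.carrier.TgtPort, tgtPort p ∉ Set.range (c.carrier.src e) := by
    rintro p ⟨i, hi⟩
    exact hlt _ p ((he i).symm.trans hi)
  have hq : ∀ j, c.left.node (Fin.natAdd k j) ∉ Set.range (c.carrier.src e) := by
    rintro j ⟨i, hi⟩
    have := congrArg Fin.val (hl ((he i).symm.trans hi))
    simp at this
    omega
  have hr' : ∀ j, c.right.node j ∉ Set.range (c.carrier.src e) := by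
    rintro j ⟨i, hi⟩
    exact hrs j ⟨⟨k, l, e⟩, i⟩ hi.symm
  have hinj : Function.Injective (c.carrier.src e) := fun i j hij =>
    eq_of_heq (Sigma.mk.inj (@hs ⟨⟨k, l, e⟩, i⟩ ⟨⟨k, l, e⟩, j⟩ hij)).2
  let x := (ofOp (c.carrier.label e)).tensor (Cospan.id S q)
  let t : discrete S l ⟶ c.carrier.erase e hs' ht' :=
    ofFun fun i => ⟨c.carrier.tgt e i, ht' ⟨⟨k, l, e⟩, i⟩⟩
  let r : discrete S q ⟶ c.carrier.erase e hs' ht' :=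
    ofFun fun j => ⟨c.left.node (Fin.natAdd k j), hq j⟩
  let d : Cospan S (l + q) m :=
    ⟨c.carrier.erase e hs' ht', discreteDesc t r, ofFun fun j => ⟨c.right.node j, hr' j⟩⟩
  let ι : d.carrier ⟶ c.carrier := c.carrier.eraseHom e hs' ht'
  let a : x.carrier ⟶ c.carrier := sumDesc (c.carrier.ofEdge e) (discreteInr S k q ≫ c.left)
  have hw : x.right ≫ a = d.left ≫ ι := by
    refine discrete_hom_ext (Fin.addCases (fun i => ?_) fun i => ?_)
    · refine (congrArg a.node (discreteDesc_node_castAdd _ _ i)).trans ?_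
      exact (congrArg ι.node (discreteDesc_node_castAdd t r i)).symm
    · refine (congrArg a.node (discreteDesc_node_natAdd _ _ i)).trans ?_
      exact (congrArg ι.node (discreteDesc_node_natAdd t r i)).symm
  have hx : x.WellFormed := (wellFormed_ofOp _).tensor (wellFormed_ofHom Function.bijective_id)
  have hn : Function.Bijective (glueDesc x.right d.left a ι hw).node := by
    refine (Function.Bijective.of_comp_iff _
      (bijective_glue_left x.right.node d.left.node (t := fun i : Fin k => .inl (.inl i)) ?_)).1 ?_
    · refine Equiv.bijective_of_comp_eq ((Equiv.sumAssoc (Fin k) (Fin l) (Fin q)).trans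
        ((Equiv.sumComm _ _).trans (finSumFinEquiv.sumCongr (Equiv.refl _)))) ?_
        Function.bijective_id
      rintro ((i | i) | i)
      · rfl
      · exact discreteDesc_node_castAdd _ _ i
      · exact discreteDesc_node_natAdd _ _ i
    · refine ⟨?_, fun v => ?_⟩
      · rintro (v | i) (w | j) hvw
        · exact congrArg Sum.inl (Subtype.ext hvw)
        · exact (v.2 ⟨j, hvw.symm⟩).elim
        · exact (w.2 ⟨i, hvw⟩).elim
        · exact congrArg Sum.inr (hinj hvw)
      · by_cases hv : v ∈ Set.range (c.carrier.src e)
        · obtain ⟨i, rfl⟩ := hv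
          exact ⟨.inr i, rfl⟩
        · exact ⟨.inl ⟨v, hv⟩, rfl⟩
  obtain ⟨α, hα⟩ := exists_iso_of_bijective (glueDesc x.right d.left a ι hw) hn (by
    have hne : ∀ {k' l' : ℕ} (e₁ : SingleEdge k l k' l') (e₂ : d.carrier.Edge k' l'),
        (c.carrier.ofEdge e).edge e₁ ≠ e₂.1 := by
      rintro _ _ ⟨⟩ e₂ h₂
      exact e₂.2 (congrArg (fun e' => (⟨_, _, e'⟩ : c.carrier.Hyperedge)) h₂.symm)
    refine fun k' l' => ⟨?_, fun e' => ?_⟩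
    · rintro ((e₁ | e₁) | e₁) ((e₂ | e₂) | e₂) h12
      · have : e₁ = e₂ := by cases e₁; cases e₂; rfl
        exact congrArg (fun e' => Sum.inl (Sum.inl e')) this
      · exact e₂.elim
      · exact (hne e₁ e₂ h12).elim
      · exact e₁.elim
      · exact e₁.elim
      · exact e₁.elim
      · exact (hne e₂ e₁ h12.symm).elim
      · exact e₂.elim
      · exact congrArg Sum.inr (Subtype.ext h12)
    · by_cases h' : (⟨k', l', e'⟩ : c.carrier.Hyperedge) = ⟨k, l, e⟩
      · cases h'
        exact ⟨.inl (.inl .edge), rfl⟩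
      · exact ⟨.inr ⟨e', h'⟩, rfl⟩)
  refine ⟨d, ⟨α, ?_, ?_⟩, fun _ => ?_⟩
  · rw [hα]
    refine discrete_hom_ext (Fin.addCases (fun i => ?_) fun i => ?_)
    · exact (congrArg a.node (discreteDesc_node_castAdd _ _ i)).trans (he i)
    · exact congrArg a.node (discreteDesc_node_natAdd _ _ i)
  · rw [hα]
    exact discrete_hom_ext fun i => rfl
  · let φ : d.carrier.Hyperedge → {h : c.carrier.Hyperedge // h ≠ ⟨k, l, e⟩} :=
      fun h => ⟨⟨h.1, h.2.1, h.2.2.1⟩, h.2.2.2⟩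
    refine (Nat.card_le_card_of_injective φ ?_).trans_lt
      (Finite.card_subtype_lt (x := ⟨k, l, e⟩) fun h => h rfl)
    rintro ⟨k1, l1, e1, h1⟩ ⟨k2, l2, e2, h2⟩ h12
    cases congrArg Subtype.val h12
    rfl

theorem WellFormed.expressible {n m : ℕ} {c : Cospan S n m} (h : c.WellFormed) :
    c.Expressible := by
  induction hN : Nat.card c.carrier.Hyperedge using Nat.strong_induction_on generalizing n m with
  | _ N ih =>
  subst hN
  rcases isEmpty_or_nonempty c.carrier.Hyperedge with _ | _
  · exact h.expressible_of_isEmpty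
  have hfin := finite_hyperedge ((wellFormed_iff c).1 h).1
  obtain ⟨⟨k, l, e⟩, -, hmin⟩ := h.wellFounded.has_min Set.univ Set.univ_nonempty
  have hsrc : ∀ i, ∃ j, c.left.node j = c.carrier.src e i := fun i => by
    obtain ⟨j | p, hj⟩ := h.tgt_bijective.2 (c.carrier.src e i)
    · exact ⟨j, hj⟩
    · exact (hmin p.1 trivial ⟨_, ⟨p.2, rfl⟩, ⟨i, hj.symm⟩⟩).elim
  obtain ⟨s, hs⟩ : ∃ s : Fin k → Fin n, ∀ i, c.left.node (s i) = c.carrier.src e i :=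
    ⟨_, fun i => (hsrc i).choose_spec⟩
  have hsi : Function.Injective s := fun i j hij => by
    have : c.carrier.src e i = c.carrier.src e j := by rw [← hs, ← hs, hij]
    exact eq_of_heq (Sigma.mk.inj (@(Sum.elim_injective.1 h.src_bijective.1).2.1
      ⟨⟨k, l, e⟩, i⟩ ⟨⟨k, l, e⟩, j⟩ this)).2
  obtain ⟨q, rfl⟩ : ∃ q, n = k + q :=
    Nat.exists_eq_add_of_le (by simpa using Fintype.card_le_of_injective s hsi)
  obtain ⟨σ, hσ⟩ := exists_perm_castAdd hsi
  let r := fun τ : Equiv.Perm (Fin (k + q)) =>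
    (ofFun τ : discrete S (k + q) ⟶ discrete S (k + q))
  have hr1 : r σ ≫ r σ.symm = 𝟙 _ := discrete_hom_ext fun i => σ.symm_apply_apply i
  have hr2 : r σ.symm ≫ r σ = 𝟙 _ := discrete_hom_ext fun i => σ.apply_symm_apply i
  let c' : Cospan S (k + q) m := ⟨c.carrier, r σ ≫ c.left, c.right⟩
  have hc' : c'.WellFormed :=
    ((wellFormed_ofHom σ.symm.bijective).comp h).of_isomorphic (ofHom_comp _ _ hr2 hr1 c)
  have hcc' : Isomorphic ((ofHom (r σ)).comp c') c := by
    have := ofHom_comp _ _ hr1 hr2 c'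
    rwa [← Category.assoc, hr2, Category.id_comp] at this
  obtain ⟨d, hd, hlt⟩ := hc'.exists_decomposition e fun i =>
    (hs i).symm.trans (congrArg c.left.node (hσ i).symm)
  have hx := (wellFormed_ofOp (c.carrier.label e)).tensor
    (wellFormed_ofHom (r := 𝟙 (discrete S q)) Function.bijective_id)
  have hd' : d.WellFormed := hx.of_comp (hc'.of_isomorphic (isomorphic_symm hd))
  refine .of_isomorphic hcc' ((expressible_perm σ).comp (.of_isomorphic hd ?_))
  exact ((expressible_ofOp _).tensor (expressible_id q)).comp (ih _ (hlt hfin) hd' rfl)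

end Cospan

end StringDiagram

/-- A cospan of labelled hypergraphs with discrete interfaces is in the image of the interpretation
of string diagrams iff it is monogamous and acyclic. -/
theorem mainTheorem2 (S : StringDiagram.Signature.{u}) (n m : ℕ)
    (c : StringDiagram.Cospan S n m) :
    (∃ t : (StringDiagram.Syn S).Hom n m,
      (StringDiagram.interpretation S).map t =
        (Quotient.mk (StringDiagram.Cospan.setoid S n m) c : (StringDiagram.Csp S).Hom n m)) ↔
      c.Monogamous ∧ c.Acyclic := by
  rw [← StringDiagram.Cospan.wellFormed_iff]
  refine ⟨?_, fun h => h.expressible⟩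
  rintro ⟨t, ht⟩
  induction t using Quotient.inductionOn with | _ t =>
  obtain ⟨d, hd, hd'⟩ := StringDiagram.Cospan.exists_wellFormed_eval t
  exact hd'.of_isomorphic (Quotient.exact (hd.symm.trans ht))
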